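/- **Setting.** Let $\mathcal X$ be a finite, nonempty abstract simplicial complex with $n$ simplices, $F$ a field, $q\ge 0$ a homology degree. For $f=(f_1,f_2):\mathcal X\to\mathbb R^2$, regarded as a point of $\mathbb R^{2n}$, and $u\in\mathbb R^2$ let $\mathcal X_u$ be the complex of all simplices $\sigma$ with $f(\tau)\le u$ (coordinatewise) for every face $\tau\subseteq\sigma$; if $f$ is monotone under inclusion of faces, this is the sublevel complex $\{\sigma : f(\sigma)\le u\}$. Let $M^f_u=H_q(\mathcal X_u;F)$, with the maps induced by inclusions. For $I\subseteq\mathbb R^2$ nonempty and connected as a poset, $\mathrm{rk}^{M^f}(I)$ is the rank of the canonical map $\varprojlim M^f|_I\to\varinjlim M^f|_I$. For $p\in\mathbb R^2$, an integer $\ell\ge 1$ and $\delta\ge 0$, the $\ell$-worm $W_\delta$ is the union of the closed sup-norm balls of radius $\delta$ centred at $p+(\alpha,-\alpha)$, $|\alpha|\le(\ell-1)\delta$. For an integer $k\ge 1$ let $$\Lambda(f)=\Lambda^{k,\ell}_p(f)=\sup\{\delta\ge 0 : \mathrm{rk}^{M^f}(W_\delta)\ge k\}\qquad(\sup\emptyset=0).$$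 For $g\in\mathbb R^{2n}\setminus\{0\}$ let $$\nabla_g\Lambda(f)=\lim_{\alpha\to 0}\frac{\Lambda(f+\alpha g)-\Lambda(f)}{\alpha\,\|g\|_\infty}$$ (two-sided limit). **Support assignment.** For $f$ with $\delta=\Lambda(f)>0$, let $e_r$ and $e_b$ be the parts of $W_\delta$ on the lines $x+y=p_1+p_2+2\delta$ and $x+y=p_1+p_2-2\delta$ (the upper and lower off-diagonal edges). The support assignment $s_f:\mathcal X\to\{\pm1,0,\pm\ell\}^2$ is given by the following rules, where the first applicable rule is used for each coordinate. For $i=1,2$: 1. $s_f(\sigma)_i=\ell$ if $f(\sigma)_i=p_i+\ell\delta$ (aligned with the right, resp. top, edge of $W_\delta$); 2. $s_f(\sigma)_i=-\ell$ if $f(\sigma)_i=p_i-\ell\delta$ (aligned with the left, resp. bottom, edge); 3. $s_f(\sigma)_i=1$ if $f(\sigma)_i$ is the $i$-th coordinate of a join on $e_r$ in the sense below; 4. $s_f(\sigma)_i=-1$ if $f(\sigma)_i$ is the $i$-th coordinate of a join on $e_b$ in the sense below; 5. $s_f(\sigma)_i=0$ otherwise. In rules 3 and 4 the joins are the points $f(\rho)\vee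 f(\tau)$ (coordinatewise maximum) lying on the given edge, with $\rho,\tau\in\mathcal X$ (possibly equal), $f(\rho)_1\le f(\tau)_1$ and $f(\tau)_2\le f(\rho)_2$; the simplex $\tau$ supplies the first coordinate and $\rho$ the second, i.e. the rules apply to $\sigma=\tau$ for $i=1$ and to $\sigma=\rho$ for $i=2$. **Proposition.** Fix $k,\ell\ge 1$ and $p\in\mathbb R^2$. There is a Lebesgue-null set $Z\subseteq\mathbb R^{2n}$ such that for every $f\in\mathbb R^{2n}\setminus Z$ with $f(\sigma)_1\ne f(\tau)_1$ and $f(\sigma)_2\ne f(\tau)_2$ for all $\sigma\ne\tau$ in $\mathcal X$, there is an assignment $s:\mathcal X\to\{\pm1,0,\pm\ell\}^2$, $s\neq 0$, such that $\nabla_g\Lambda(f)$ exists for every $g\ne 0$, and $$\nabla_s\Lambda(f)=\max_{g\in\mathbb R^{2n}\setminus\{0\}}\nabla_g\Lambda(f).$$ Moreover, if $\Lambda(f)>0$, then $s$ is the support assignment $s_f$. -/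

import Mathlib

open Set Filter Topology MeasureTheory CategoryTheory CategoryTheory.Limits

noncomputable section

namespace GRIL

universe u v w

attribute [local instance 10000] Preorder.smallCategory

/-! ## Simplicial homology of subcomplexes, as a functor -/

section Homology

/-- Formal linear combinations, with coefficients in `F`, of finite sets of vertices. -/
def Chain (F : Type u) [Field F] (V : Type v) : Type (max u v) := Finset V →₀ F

instance (F : Type u) [Field F] (V : Type v) : AddCommGroup (Chain F V) :=
  inferInstanceAs (AddCommGroup (Finset V →₀ F))

instance (F : Type u) [Field F] (V : Type v) : Module F (Chain F V) :=
  inferInstanceAs (Module F (Finset V →₀ F))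

/-- The basis chain of a finite vertex set. -/
def Chain.single (F : Type u) [Field F] {V : Type v} (σ : Finset V) : Chain F V :=
  Finsupp.single σ (1 : F)

/-- The simplicial boundary operator: the `i`-th vertex of `σ` (in increasing order, counted from
`0`) is removed with the sign `(-1) ^ i`. Vertices have boundary zero (unreduced homology). -/
def boundary (F : Type u) [Field F] (V : Type v) [LinearOrder V] : Chain F V →ₗ[F] Chain F V :=
  Finsupp.linearCombination F fun σ : Finset V =>
    if 2 ≤ σ.card then
      ∑ x ∈ σ, (-1 : F) ^ (σ.filter (fun y => y < x)).card • Chain.single F (σ.erase x)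
    else 0

/-- The simplicial `q`-chains of the complex `K`: the span of its simplices with `q + 1`
vertices. -/
def chains (F : Type u) [Field F] {V : Type v} (q : ℕ) (K : PreAbstractSimplicialComplex V) :
    Submodule F (Chain F V) :=
  Finsupp.supported F F {σ : Finset V | σ ∈ K.faces ∧ σ.card = q + 1}

theorem chains_mono (F : Type u) [Field F] {V : Type v} (q : ℕ)
    {K L : PreAbstractSimplicialComplex V} (h : K ≤ L) : chains F q K ≤ chains F q L :=
  Finsupp.supported_mono (M := F) (R := F) fun _ hσ => ⟨h hσ.1, hσ.2⟩

variable (F : Type u) [Field F] {V : Type v} [LinearOrder V]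

/-- The simplicial `q`-cycles of the complex `K`. -/
def cycles (q : ℕ) (K : PreAbstractSimplicialComplex V) : Submodule F (Chain F V) :=
  chains F q K ⊓ LinearMap.ker (boundary F V)

/-- The simplicial `q`-boundaries of the complex `K`. -/
def boundaries (q : ℕ) (K : PreAbstractSimplicialComplex V) : Submodule F (Chain F V) :=
  (chains F (q + 1) K).map (boundary F V)

/-- The `q`-th simplicial homology of `K` with coefficients in `F`: cycles modulo boundaries. -/
abbrev Homology (q : ℕ) (K : PreAbstractSimplicialComplex V) : Type (max u v) :=
  ↥(cycles F q K) ⧸ (boundaries F q K).submoduleOf (cycles F q K)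

theorem cycles_mono (q : ℕ) {K L : PreAbstractSimplicialComplex V} (h : K ≤ L) :
    cycles F q K ≤ cycles F q L :=
  inf_le_inf_right _ (chains_mono F q h)

theorem boundaries_mono (q : ℕ) {K L : PreAbstractSimplicialComplex V} (h : K ≤ L) :
    boundaries F q K ≤ boundaries F q L :=
  Submodule.map_mono (chains_mono F (q + 1) h)

/-- The linear map in homology induced by the inclusion of a subcomplex. -/
def homologyMap (q : ℕ) {K L : PreAbstractSimplicialComplex V} (h : K ≤ L) :
    Homology F q K →ₗ[F] Homology F q L :=
  Submodule.mapQ _ _ (Submodule.inclusion (cycles_mono F q h))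
    fun _ hx => boundaries_mono F q h hx

/-- Simplicial homology as a functor on the poset of complexes on the vertex type `V`. -/
def homologyFunctor (V : Type v) [LinearOrder V] (q : ℕ) :
    PreAbstractSimplicialComplex V ⥤ ModuleCat.{max u v} F where
  obj K := ModuleCat.of F (Homology F q K)
  map h := ModuleCat.ofHom (homologyMap F q h.le)
  map_id K := by
    ext x
    rfl
  map_comp h₁ h₂ := by
    ext x
    rfl

end Homology

/-! ## The two-parameter persistence module of a filtration function -/

section Persistence

variable {V : Type v}

/-- The complex of all simplices of `X` all of whose faces have value at most `u` (in the product
order of the plane). If `f` is monotone under inclusion of faces, this is `{σ | f σ ≤ u}`; for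
arbitrary `f` it is the largest subcomplex of `X` contained in `{σ | f σ ≤ u}`. -/
def sublevel (X : PreAbstractSimplicialComplex V) (f : X.faces → ℝ × ℝ) (u : ℝ × ℝ) :
    PreAbstractSimplicialComplex V where
  faces := {σ | σ ∈ X.faces ∧ ∀ τ : X.faces, (τ : Finset V) ⊆ σ → f τ ≤ u}
  isRelLowerSet_faces := fun _ hσ =>
    ⟨(X.isRelLowerSet_faces hσ.1).1, fun _ hτσ hτ =>
      ⟨(X.isRelLowerSet_faces hσ.1).2 hτσ hτ, fun ρ hρ => hσ.2 ρ (hρ.trans hτσ)⟩⟩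

theorem sublevel_mono (X : PreAbstractSimplicialComplex V) (f : X.faces → ℝ × ℝ) :
    Monotone (sublevel X f) :=
  fun _ _ huv _ hσ => ⟨hσ.1, fun τ hτ => (hσ.2 τ hτ).trans huv⟩

/-- The two-parameter persistence module `M^f` in homology degree `q`. -/
def persistenceModule (F : Type u) [Field F] [LinearOrder V] (q : ℕ)
    (X : PreAbstractSimplicialComplex V) (f : X.faces → ℝ × ℝ) :
    (ℝ × ℝ) ⥤ ModuleCat.{max u v} F :=
  (sublevel_mono X f).functor ⋙ homologyFunctor F V q

end Persistence

/-! ## Generalized rank -/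

section Rank

/-- The canonical map from the limit to the colimit of a diagram of nonempty shape: project to an
object of the diagram and include. For a connected shape it does not depend on the object, see
`limitToColimit_eq`. -/
def limitToColimit {J : Type v} [Category.{w} J] [Nonempty J] {C : Type*} [Category C]
    (D : J ⥤ C) [HasLimit D] [HasColimit D] : limit D ⟶ colimit D :=
  limit.π D (Classical.arbitrary J) ≫ colimit.ι D (Classical.arbitrary J)

theorem limitToColimit_eq {J : Type v} [Category.{w} J] [IsConnected J] {C : Type*} [Category C]
    (D : J ⥤ C) [HasLimit D] [HasColimit D] (j : J) :
    limitToColimit D = limit.π D j ≫ colimit.ι D j :=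
  constant_of_preserves_morphisms (fun j => limit.π D j ≫ colimit.ι D j)
    (fun i j g => by rw [← limit.w D g, Category.assoc, colimit.w]) _ _

/-- The restriction `M|_I` of a persistence module to a subset of the plane. -/
def restrict {F : Type u} [Field F] (M : (ℝ × ℝ) ⥤ ModuleCat.{max u v} F) (I : Set (ℝ × ℝ)) :
    I ⥤ ModuleCat.{max u v} F :=
  Monotone.functor (f := fun u : I => (u : ℝ × ℝ)) (fun _ _ h => h) ⋙ M

/-- The generalized rank of `M` over a nonempty set `I`: the rank of the canonical map from the
limit to the colimit of `M|_I`. -/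
def genRank {F : Type u} [Field F] (M : (ℝ × ℝ) ⥤ ModuleCat.{max u v} F) (I : Set (ℝ × ℝ))
    [Nonempty I] : ℕ :=
  Module.finrank F (LinearMap.range (limitToColimit (restrict M I)).hom)

end Rank

/-! ## Worms and the landscape -/

/-- The `ℓ`-worm of width `δ` centred at `p`: the union of the closed sup-norm balls of radius `δ`
centred on the segment `p + (α, -α)`, `|α| ≤ (ℓ - 1) δ`. -/
def worm (p : ℝ × ℝ) (ℓ : ℕ) (δ : ℝ) : Set (ℝ × ℝ) :=
  ⋃ α ∈ {α : ℝ | |α| ≤ ((ℓ : ℝ) - 1) * δ}, Metric.closedBall (p + (α, -α)) δ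

/-- The generalized rank invariant landscape
`λ^M(p, k, ℓ) = sup {δ ≥ 0 | rk^M (worm p ℓ δ) ≥ k}`, where the supremum of the empty subset of
`[0, ∞)` is `0`. -/
def landscape {F : Type u} [Field F] (M : (ℝ × ℝ) ⥤ ModuleCat.{max u v} F) (p : ℝ × ℝ)
    (k ℓ : ℕ) : ℝ :=
  sSup {δ : ℝ | 0 ≤ δ ∧ ∃ _ : Nonempty (worm p ℓ δ), k ≤ genRank M (worm p ℓ δ)}

/-- The function `Λ_p^{k,ℓ}` on filtration functions. -/
def Lam (F : Type u) [Field F] {V : Type v} [LinearOrder V] (q : ℕ)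
    (X : PreAbstractSimplicialComplex V) (p : ℝ × ℝ) (k ℓ : ℕ) (f : X.faces → ℝ × ℝ) : ℝ :=
  landscape (persistenceModule F q X f) p k ℓ

/-- `d` is the derivative of `Λ` at `f` in the direction `g`, normalized by the sup norm of `g`
(the limit is two-sided). -/
def HasNormalizedDeriv {E : Type*} [NormedAddCommGroup E] [NormedSpace ℝ E] (Λ : E → ℝ)
    (f g : E) (d : ℝ) : Prop :=
  Tendsto (fun α : ℝ => (Λ (f + α • g) - Λ f) / (α * ‖g‖)) (𝓝[≠] 0) (𝓝 d)

/-! ## Support simplices -/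

/-- The off-diagonal edge of the worm which bounds it from above. -/
def upperEdge (p : ℝ × ℝ) (ℓ : ℕ) (δ : ℝ) : Set (ℝ × ℝ) :=
  {w ∈ worm p ℓ δ | w.1 + w.2 = p.1 + p.2 + 2 * δ}

/-- The off-diagonal edge of the worm which bounds it from below. -/
def lowerEdge (p : ℝ × ℝ) (ℓ : ℕ) (δ : ℝ) : Set (ℝ × ℝ) :=
  {w ∈ worm p ℓ δ | w.1 + w.2 = p.1 + p.2 - 2 * δ}

/-- The join `f σ ∨ f τ` lies on `E`, takes its first coordinate from `τ` and its second
coordinate from `σ`. -/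
def JoinOn {ι : Type*} (E : Set (ℝ × ℝ)) (f : ι → ℝ × ℝ) (σ τ : ι) : Prop :=
  f σ ⊔ f τ ∈ E ∧ (f σ).1 ≤ (f τ).1 ∧ (f τ).2 ≤ (f σ).2

open Classical in
/-- The assignment given by the support simplices on the boundary of the worm of width `δ`. A
coordinate of `f σ` aligned with a vertical or horizontal edge gets `± ℓ`; a coordinate of `f σ`
which is a coordinate of a join on an off-diagonal edge gets `± 1`; the sign points outwards. All
other coordinates get `0`. -/
def supportAssignment {ι : Type*} (p : ℝ × ℝ) (ℓ : ℕ) (δ : ℝ) (f : ι → ℝ × ℝ) (σ : ι) : ℝ × ℝ :=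
  (if (f σ).1 = p.1 + ℓ * δ then (ℓ : ℝ)
    else if (f σ).1 = p.1 - ℓ * δ then -(ℓ : ℝ)
    else if ∃ ρ, JoinOn (upperEdge p ℓ δ) f ρ σ then 1
    else if ∃ ρ, JoinOn (lowerEdge p ℓ δ) f ρ σ then -1
    else 0,
   if (f σ).2 = p.2 + ℓ * δ then (ℓ : ℝ)
    else if (f σ).2 = p.2 - ℓ * δ then -(ℓ : ℝ)
    else if ∃ τ, JoinOn (upperEdge p ℓ δ) f σ τ then 1
    else if ∃ τ, JoinOn (lowerEdge p ℓ δ) f σ τ then -1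
    else 0)

end GRIL

end

/-!
A worm is a hexagon: a square around `p` intersected with a strip around the antidiagonal through
`p`. Suppose that no value of `f` is aligned with an axis-parallel edge of the worm of width `δ` and
that no join of two values lies on an off-diagonal edge. Then the sublevel complexes do not change
under clamping points of a slightly larger worm to the square of the smaller one. A cell at an
off-diagonal edge that contains no join can be crossed in one of the two coordinate directions
without changing the sublevel complex, which connects indices on its two sides by zigzags. Hence
cones and cocones over the smaller worm extend to the larger one, and the rank of the larger worm is
at least that of the smaller. At `δ = Λ(f) > 0` this is impossible, so some value is aligned with an
edge or some join lies on an off-diagonal edge.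

Each such support determines the width as an affine function of `f` whose gradient is a positive
multiple of its support vector `s`. Two of these finitely many affine functions with different
support vectors agree only on a hyperplane. Outside these hyperplanes the support vector at `f` is
unique, and since `Λ` is continuous, it coincides near `f` with the corresponding affine function.
All nonzero entries of `s` have the same absolute value, so `s` maximises the derivative relative to
the sup norm. Where `Λ` vanishes it is minimal, so its derivative there is zero; the derivative
exists almost everywhere by Rademacher's theorem, because shifting worms diagonally shows that `Λ`
is `1`-Lipschitz.
-/

noncomputable section

namespace GRIL

universe u v

-- `ℝ × ℝ` is also a category as a product of two categories.
attribute [local instance 10000] Preorder.smallCategory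

section Transport

variable {P I J J' : Type*} [Preorder P] [Preorder I] [Preorder J] [Preorder J']
  {K : I → P} {K' : J → P} {K'' : J' → P} {a b : J → I}

theorem rel_of_zigzag {r : I → I → Prop} (hr : Equivalence r) (h : ∀ ⦃i j⦄, i ≤ j → r i j)
    {i j : I} (hij : Zigzag i j) : r i j := by
  induction hij with
  | refl => exact hr.refl i
  | tail _ hjk ih =>
    exact hjk.elim (fun ⟨f⟩ => hr.trans ih (h f.le)) (fun ⟨f⟩ => hr.trans ih (hr.symm (h f.le)))

theorem zigzag_of_le {i j : I} (h : i ≤ j) : Zigzag i j := Zigzag.of_hom (homOfLE h)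

theorem zigzag_map {m : I → J} (hm : ∀ ⦃i j⦄, i ≤ j → Zigzag (m i) (m j)) {i j : I}
    (hij : Zigzag i j) : Zigzag (m i) (m j) :=
  rel_of_zigzag (zigzag_equivalence.comap m) hm hij

/-- A choice of indices `a j` with `K (a j) ≤ K' j` which is compatible with `i ≤ j` up to a zigzag
of indices staying below `K' j`. It turns cones over `K` into cones over `K'`, for every functor on
`P`. -/
structure LowerTransport (K : I → P) (K' : J → P) (a : J → I) : Prop where
  le (j : J) : K (a j) ≤ K' j
  zigzag ⦃i j : J⦄ (hij : i ≤ j) :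
    ∃ h : K (a i) ≤ K' j, Zigzag (⟨a i, h⟩ : {w // K w ≤ K' j}) ⟨a j, le j⟩

/-- The dual of `LowerTransport`: it turns cocones over `K` into cocones over `K'`. -/
structure UpperTransport (K : I → P) (K' : J → P) (b : J → I) : Prop where
  le (j : J) : K' j ≤ K (b j)
  zigzag ⦃i j : J⦄ (hij : i ≤ j) :
    ∃ h : K' i ≤ K (b j), Zigzag (⟨b i, le i⟩ : {w // K' i ≤ K w}) ⟨b j, h⟩

theorem LowerTransport.of_monotone (hK : Monotone K) (ha : Monotone a) (h : ∀ j, K (a j) ≤ K' j) :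
    LowerTransport K K' a :=
  ⟨h, fun _ j hij => ⟨(hK (ha hij)).trans (h j), zigzag_of_le (ha hij)⟩⟩

theorem UpperTransport.of_monotone (hK : Monotone K) (hb : Monotone b) (h : ∀ j, K' j ≤ K (b j)) :
    UpperTransport K K' b :=
  ⟨h, fun i _ hij => ⟨(h i).trans (hK (hb hij)), zigzag_of_le (hb hij)⟩⟩

theorem LowerTransport.of_fence (hK : Monotone K) (h : ∀ j, K (a j) ≤ K' j)
    (hfence : ∀ ⦃i j⦄, i ≤ j → ∃ m m', a i ≤ m ∧ m' ≤ m ∧ m' ≤ a j ∧ K m ≤ K' j) :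
    LowerTransport K K' a := by
  refine ⟨h, fun i j hij => ?_⟩
  obtain ⟨m, m', him, hm, hmj, hj⟩ := hfence hij
  let n : {w // K w ≤ K' j} := ⟨m, hj⟩
  let n' : {w // K w ≤ K' j} := ⟨m', (hK hm).trans hj⟩
  have hin : (⟨a i, (hK him).trans hj⟩ : {w // K w ≤ K' j}) ≤ n := him
  have hn : n' ≤ n := hm
  have hnj : n' ≤ ⟨a j, h j⟩ := hmj
  exact ⟨_, (zigzag_of_le hin).trans ((zigzag_of_le hn).symm.trans (zigzag_of_le hnj))⟩

theorem LowerTransport.trans {a' : J' → J} (ha : LowerTransport K K' a)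
    (ha' : LowerTransport K' K'' a') : LowerTransport K K'' (a ∘ a') where
  le j := (ha.le (a' j)).trans (ha'.le j)
  zigzag i j hij := by
    obtain ⟨h, hzig⟩ := ha'.zigzag hij
    let m (w : {w // K' w ≤ K'' j}) : {w // K w ≤ K'' j} := ⟨a w, (ha.le w).trans w.2⟩
    refine ⟨(m ⟨_, h⟩).2, zigzag_map (m := m) (fun v w hvw => ?_) hzig⟩
    obtain ⟨_, hzig'⟩ := ha.zigzag (show v.1 ≤ w.1 from hvw)
    exact zigzag_map (m := fun x : {x // K x ≤ K' w} => (⟨x, x.2.trans w.2⟩ : {x // K x ≤ K'' j}))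
      (fun _ _ hxy => zigzag_of_le hxy) hzig'

open OrderDual in
theorem LowerTransport.reflect {eI : I → I} {eJ : J → J} (heI : Antitone eI) (heJ : Antitone eJ)
    (hinv : Function.Involutive eJ)
    (ha : LowerTransport (toDual ∘ K ∘ eI) (toDual ∘ K' ∘ eJ) a) :
    UpperTransport K K' (eI ∘ a ∘ eJ) where
  le j := by simpa only [Function.comp_apply, hinv j, toDual_le_toDual] using ha.le (eJ j)
  zigzag i j hij := by
    have hmem {w : I} (hw : (toDual ∘ K ∘ eI) w ≤ (toDual ∘ K' ∘ eJ) (eJ i)) :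
        K' i ≤ K (eI w) := by
      simpa only [Function.comp_apply, hinv i, toDual_le_toDual] using hw
    have he : Antitone fun w : {w // (toDual ∘ K ∘ eI) w ≤ (toDual ∘ K' ∘ eJ) (eJ i)} =>
        (⟨eI w, hmem w.2⟩ : {w // K' i ≤ K w}) := fun _ _ hvw => heI hvw
    obtain ⟨h, hzig⟩ := ha.zigzag (heJ hij)
    exact ⟨hmem h, zigzag_map (fun _ _ hvw => (zigzag_of_le (he hvw)).symm) hzig.symm⟩

end Transport

section Rank

variable {P I J : Type*} [Preorder P] [Preorder I] [Preorder J] {C : Type*} [Category C]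
  {K : I ⥤ P} {K' : J ⥤ P} {G : P ⥤ C} {a b : J → I}

theorem cone_leg_eq_of_zigzag (c : Cone (K ⋙ G)) {x : P} {v w : {w // K.obj w ≤ x}}
    (h : Zigzag v w) :
    c.π.app v.1 ≫ G.map (homOfLE v.2) = c.π.app w.1 ≫ G.map (homOfLE w.2) := by
  refine rel_of_zigzag (eq_equivalence.comap
    fun w : {w // K.obj w ≤ x} => c.π.app w.1 ≫ G.map (homOfLE w.2)) (fun v w hvw => ?_) h
  change c.π.app v.1 ≫ G.map (homOfLE v.2) = c.π.app w.1 ≫ G.map (homOfLE w.2)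
  have hvw' : v.1 ≤ w.1 := hvw
  rw [← c.w (homOfLE hvw'), Functor.comp_map, Category.assoc, ← G.map_comp]
  rfl

theorem cocone_leg_eq_of_zigzag (c : Cocone (K ⋙ G)) {x : P} {v w : {w // x ≤ K.obj w}}
    (h : Zigzag v w) :
    G.map (homOfLE v.2) ≫ c.ι.app v.1 = G.map (homOfLE w.2) ≫ c.ι.app w.1 := by
  refine rel_of_zigzag (eq_equivalence.comap
    fun w : {w // x ≤ K.obj w} => G.map (homOfLE w.2) ≫ c.ι.app w.1) (fun v w hvw => ?_) h
  change G.map (homOfLE v.2) ≫ c.ι.app v.1 = G.map (homOfLE w.2) ≫ c.ι.app w.1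
  have hvw' : v.1 ≤ w.1 := hvw
  rw [← c.w (homOfLE hvw'), Functor.comp_map, ← Category.assoc, ← G.map_comp]
  rfl

/-- The cone over `K'` obtained from a cone over `K` by composing its legs at the chosen indices
with the structure maps. -/
def LowerTransport.cone (ha : LowerTransport K.obj K'.obj a) (c : Cone (K ⋙ G)) :
    Cone (K' ⋙ G) where
  pt := c.pt
  π :=
    { app j := c.π.app (a j) ≫ G.map (homOfLE (ha.le j))
      naturality i j hij := by
        obtain ⟨_, hzig⟩ := ha.zigzag hij.le
        refine (Category.id_comp _).trans ((cone_leg_eq_of_zigzag c hzig).symm.trans ?_)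
        rw [Functor.comp_map, Category.assoc, ← G.map_comp]
        rfl }

/-- The cocone over `K'` obtained from a cocone over `K` by composing the structure maps with its
legs at the chosen indices. -/
def UpperTransport.cocone (hb : UpperTransport K.obj K'.obj b) (c : Cocone (K ⋙ G)) :
    Cocone (K' ⋙ G) where
  pt := c.pt
  ι :=
    { app j := G.map (homOfLE (hb.le j)) ≫ c.ι.app (b j)
      naturality i j hij := by
        obtain ⟨_, hzig⟩ := hb.zigzag hij.le
        refine Eq.trans ?_ ((cocone_leg_eq_of_zigzag c hzig).symm.trans (Category.comp_id _).symm)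
        rw [Functor.comp_map, ← Category.assoc, ← G.map_comp]
        rfl }

theorem limitToColimit_eq_lift_comp_comp_desc [CategoryTheory.IsConnected I]
    [CategoryTheory.IsConnected J] [HasLimit (K ⋙ G)] [HasColimit (K ⋙ G)] [HasLimit (K' ⋙ G)]
    [HasColimit (K' ⋙ G)] (ha : LowerTransport K.obj K'.obj a)
    (hb : UpperTransport K.obj K'.obj b) {j : J} (hab : a j ≤ b j) :
    limitToColimit (K ⋙ G) =
      limit.lift _ (ha.cone (limit.cone _)) ≫ limitToColimit (K' ⋙ G) ≫
        colimit.desc _ (hb.cocone (colimit.cocone _)) := by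
  have hlift : limit.lift _ (ha.cone (limit.cone (K ⋙ G))) ≫ limit.π (K' ⋙ G) j =
      limit.π (K ⋙ G) (a j) ≫ G.map (homOfLE (ha.le j)) := limit.lift_π _ j
  have hdesc : colimit.ι (K' ⋙ G) j ≫ colimit.desc _ (hb.cocone (colimit.cocone (K ⋙ G))) =
      G.map (homOfLE (hb.le j)) ≫ colimit.ι (K ⋙ G) (b j) := colimit.ι_desc _ j
  have hK : limitToColimit (K ⋙ G) =
      (limit.π (K ⋙ G) (a j) ≫ G.map (homOfLE (ha.le j))) ≫
        G.map (homOfLE (hb.le j)) ≫ colimit.ι (K ⋙ G) (b j) := by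
    rw [limitToColimit_eq _ (a j), ← colimit.w (K ⋙ G) (homOfLE hab), Category.assoc,
      ← G.map_comp_assoc]
    rfl
  refine (hK.trans (congrArg₂ (fun x y => x ≫ y) hlift hdesc).symm).trans ?_
  simp only [limitToColimit_eq _ j, Category.assoc]
  rfl

theorem finrank_range_comp_comp_le {R M₁ M₂ M₃ M₄ : Type*} [DivisionRing R] [AddCommGroup M₁]
    [Module R M₁] [AddCommGroup M₂] [Module R M₂] [AddCommGroup M₃] [Module R M₃]
    [AddCommGroup M₄] [Module R M₄] (f : M₁ →ₗ[R] M₂) (g : M₂ →ₗ[R] M₃) (h : M₃ →ₗ[R] M₄)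
    [Module.Finite R g.range] :
    Module.finrank R (h ∘ₗ g ∘ₗ f).range ≤ Module.finrank R g.range := by
  have hle : (g ∘ₗ f).range ≤ g.range := LinearMap.range_comp_le_range f g
  have := Submodule.finiteDimensional_of_le hle
  rw [LinearMap.range_comp]
  exact (Submodule.finrank_map_le _ _).trans (Submodule.finrank_mono hle)

variable {F : Type u} [Field F] {S T : Set (ℝ × ℝ)}

theorem finite_range_limitToColimit [Nonempty I] (D : I ⥤ ModuleCat F) [HasLimit D] [HasColimit D]
    [∀ i, Module.Finite F (D.obj i)] : Module.Finite F (limitToColimit D).hom.range := by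
  rw [limitToColimit, ModuleCat.hom_comp, LinearMap.range_comp]
  infer_instance

theorem genRank_le_finrank (M : (ℝ × ℝ) ⥤ ModuleCat.{max u v} F) [∀ u, Module.Finite F (M.obj u)]
    [CategoryTheory.IsConnected S] (u : S) :
    genRank M S ≤ Module.finrank F (M.obj u) := by
  have h : limitToColimit (restrict M S) =
      limit.π _ u ≫ 𝟙 ((restrict M S).obj u) ≫ colimit.ι _ u := by
    rw [limitToColimit_eq _ u, Category.id_comp]
  rw [genRank, h, ← finrank_top F (M.obj u), ← LinearMap.range_id]
  have : Module.Finite F ((restrict M S).obj u) := inferInstanceAs (Module.Finite F (M.obj u))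
  exact finrank_range_comp_comp_le (limit.π (restrict M S) u).hom
    (LinearMap.id : (restrict M S).obj u →ₗ[F] _) (colimit.ι (restrict M S) u).hom

theorem genRank_le_genRank {κ κ' : ℝ × ℝ ⥤ P} (G : P ⥤ ModuleCat.{max u v} F)
    [∀ u, Module.Finite F ((κ' ⋙ G).obj u)]
    [CategoryTheory.IsConnected S] [CategoryTheory.IsConnected T] {a b : T → S}
    (ha : LowerTransport (S.domRestrict κ.obj) (T.domRestrict κ'.obj) a)
    (hb : UpperTransport (S.domRestrict κ.obj) (T.domRestrict κ'.obj) b) {j : T}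
    (hab : a j ≤ b j) : genRank (κ ⋙ G) S ≤ genRank (κ' ⋙ G) T := by
  let ι (U : Set (ℝ × ℝ)) : U ⥤ ℝ × ℝ :=
    Monotone.functor (f := fun u : U => (u : ℝ × ℝ)) fun _ _ h => h
  have h := limitToColimit_eq_lift_comp_comp_desc (K := ι S ⋙ κ) (K' := ι T ⋙ κ') (G := G) ha hb hab
  have (i : T) : Module.Finite F ((restrict (κ' ⋙ G) T).obj i) :=
    inferInstanceAs (Module.Finite F ((κ' ⋙ G).obj i))
  have := finite_range_limitToColimit (restrict (κ' ⋙ G) T)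
  change Module.finrank F (limitToColimit ((ι S ⋙ κ) ⋙ G)).hom.range ≤ _
  rw [h]
  exact finrank_range_comp_comp_le _ (limitToColimit (restrict (κ' ⋙ G) T)).hom _

end Rank

section Sublevel

theorem sublevel_le_sublevel {V : Type v} {X : PreAbstractSimplicialComplex V}
    {f f' : X.faces → ℝ × ℝ} {u u' : ℝ × ℝ} (h : ∀ τ, f τ ≤ u → f' τ ≤ u') :
    sublevel X f u ≤ sublevel X f' u' :=
  fun _ hσ => ⟨hσ.1, fun τ hτ => h τ (hσ.2 τ hτ)⟩

variable (F : Type u) [Field F] {V : Type v} [LinearOrder V] (q : ℕ)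

theorem finite_homology {K : PreAbstractSimplicialComplex V} (hK : K.faces.Finite) :
    Module.Finite F (Homology F q K) := by
  have : Finite {σ : Finset V | σ ∈ K.faces ∧ σ.card = q + 1} := hK.subset fun _ h => h.1
  have : Module.Finite F (chains F q K) :=
    Module.Finite.equiv (Finsupp.supportedEquivFinsupp
      (M := F) (R := F) {σ : Finset V | σ ∈ K.faces ∧ σ.card = q + 1}).symm
  have : Module.Finite F (cycles F q K) :=
    Submodule.finiteDimensional_of_le (S₂ := chains F q K) inf_le_left
  infer_instance

theorem subsingleton_homology {K : PreAbstractSimplicialComplex V} (hK : K.faces = ∅) :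
    Subsingleton (Homology F q K) := by
  have h : chains F q K = ⊥ := by
    simp only [chains, hK, mem_empty_iff_false, false_and]
    exact Finsupp.supported_empty
  have : Subsingleton (cycles F q K) := by
    rw [cycles, h, bot_inf_eq]
    infer_instance
  infer_instance

variable {X : PreAbstractSimplicialComplex V} {f f' : X.faces → ℝ × ℝ} {S T : Set (ℝ × ℝ)}
  [CategoryTheory.IsConnected S]

instance [Finite X.faces] (u : ℝ × ℝ) : Module.Finite F ((persistenceModule F q X f).obj u) :=
  finite_homology F q ((Set.toFinite X.faces).subset fun _ h => h.1)

theorem genRank_persistenceModule_eq_zero [Finite X.faces] {u : ℝ × ℝ} (hu : u ∈ S)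
    (h : ∀ σ, ¬ f σ ≤ u) : genRank (persistenceModule F q X f) S = 0 := by
  have hempty : (sublevel X f u).faces = ∅ :=
    eq_empty_of_forall_notMem fun σ hσ => h ⟨σ, hσ.1⟩ (hσ.2 _ subset_rfl)
  have : Subsingleton ((persistenceModule F q X f).obj u) := subsingleton_homology F q hempty
  refine Nat.le_zero.1 ((genRank_le_finrank _ ⟨u, hu⟩).trans_eq ?_)
  exact Module.finrank_zero_of_subsingleton

theorem genRank_persistenceModule_le [Finite X.faces] [CategoryTheory.IsConnected T] {a b : T → S}
    (ha : LowerTransport (S.domRestrict (sublevel X f)) (T.domRestrict (sublevel X f')) a)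
    (hb : UpperTransport (S.domRestrict (sublevel X f)) (T.domRestrict (sublevel X f')) b) {j : T}
    (hab : a j ≤ b j) :
    genRank (persistenceModule F q X f) S ≤ genRank (persistenceModule F q X f') T := by
  have (u : ℝ × ℝ) : Module.Finite F
      (((sublevel_mono X f').functor ⋙ homologyFunctor F V q).obj u) :=
    inferInstanceAs (Module.Finite F ((persistenceModule F q X f').obj u))
  exact genRank_le_genRank (κ := (sublevel_mono X f).functor) (κ' := (sublevel_mono X f').functor)
    (homologyFunctor F V q) ha hb hab

end Sublevel

section Hexagon

variable {p u : ℝ × ℝ} {L L' t t' : ℝ}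

/-- The hexagon cut out of the square of radius `L` around `p` by the strip of half-width `t` around
the antidiagonal through `p`. The worms are the hexagons with `L = ℓ δ` and `t = 2 δ`. -/
def hexagon (p : ℝ × ℝ) (L t : ℝ) : Set (ℝ × ℝ) :=
  {u | |u.1 - p.1| ≤ L ∧ |u.2 - p.2| ≤ L ∧ |u.1 - p.1 + (u.2 - p.2)| ≤ t}

theorem mem_hexagon_iff : u ∈ hexagon p L t ↔
    (p.1 - L ≤ u.1 ∧ u.1 ≤ p.1 + L) ∧ (p.2 - L ≤ u.2 ∧ u.2 ≤ p.2 + L) ∧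
      (p.1 + p.2 - t ≤ u.1 + u.2 ∧ u.1 + u.2 ≤ p.1 + p.2 + t) := by
  simp only [hexagon, mem_ofPred_eq, abs_le]
  constructor
  · rintro ⟨⟨h₁, h₂⟩, ⟨h₃, h₄⟩, h₅, h₆⟩
    exact ⟨⟨by linarith, by linarith⟩, ⟨by linarith, by linarith⟩, by linarith, by linarith⟩
  · rintro ⟨⟨h₁, h₂⟩, ⟨h₃, h₄⟩, h₅, h₆⟩
    exact ⟨⟨by linarith, by linarith⟩, ⟨by linarith, by linarith⟩, by linarith, by linarith⟩

theorem worm_eq_hexagon {ℓ : ℕ} (hℓ : 1 ≤ ℓ) {δ : ℝ} (hδ : 0 ≤ δ) :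
    worm p ℓ δ = hexagon p (ℓ * δ) (2 * δ) := by
  have hr : 0 ≤ ((ℓ : ℝ) - 1) * δ := mul_nonneg (by simpa using hℓ) hδ
  have hL : (ℓ : ℝ) * δ = ((ℓ : ℝ) - 1) * δ + δ := by ring
  ext u
  simp only [worm, mem_iUnion, mem_ofPred_eq, Metric.mem_closedBall, Prod.dist_eq, max_le_iff,
    Real.dist_eq, abs_le, exists_prop, Prod.fst_add, Prod.snd_add, mem_hexagon_iff, hL]
  generalize ((ℓ : ℝ) - 1) * δ = r at hr
  constructor
  · rintro ⟨α, ⟨h₁, h₂⟩, ⟨h₃, h₄⟩, h₅, h₆⟩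
    exact ⟨⟨by linarith, by linarith⟩, ⟨by linarith, by linarith⟩, by linarith, by linarith⟩
  · rintro ⟨⟨h₁, h₂⟩, ⟨h₃, h₄⟩, h₅, h₆⟩
    -- The least admissible centre: the largest of the three lower bounds on `α`.
    set β := max (u.1 - p.1 - δ) (p.2 - u.2 - δ)
    have hβ₁ : u.1 - p.1 - δ ≤ max β (-r) := (le_max_left _ _).trans (le_max_left _ _)
    have hβ₂ : p.2 - u.2 - δ ≤ max β (-r) := (le_max_right _ _).trans (le_max_left _ _)
    have hβ {c : ℝ} (h : u.1 - p.1 - δ ≤ c) (h' : p.2 - u.2 - δ ≤ c) (h'' : -r ≤ c) :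
        max β (-r) ≤ c := max_le (max_le h h') h''
    have hup₁ := hβ (c := u.1 - p.1 + δ) (by linarith) (by linarith) (by linarith)
    have hup₂ := hβ (c := p.2 - u.2 + δ) (by linarith) (by linarith) (by linarith)
    exact ⟨max β (-r), ⟨le_max_right _ _, hβ (by linarith) (by linarith) (by linarith)⟩,
      ⟨by linarith, by linarith⟩, by linarith, by linarith⟩

theorem sup_mem_hexagon {v : ℝ × ℝ} (hu : u ∈ hexagon p L t) (hv : v ∈ hexagon p L t)
    (h : (u ⊔ v).1 + (u ⊔ v).2 ≤ p.1 + p.2 + t) : u ⊔ v ∈ hexagon p L t := by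
  obtain ⟨⟨hu₁, hu₁'⟩, ⟨hu₂, hu₂'⟩, hu₃, -⟩ := mem_hexagon_iff.1 hu
  obtain ⟨⟨-, hv₁'⟩, ⟨-, hv₂'⟩, -⟩ := mem_hexagon_iff.1 hv
  have hle : u ≤ u ⊔ v := le_sup_left
  exact mem_hexagon_iff.2 ⟨⟨hu₁.trans hle.1, sup_le hu₁' hv₁'⟩,
    ⟨hu₂.trans hle.2, sup_le hu₂' hv₂'⟩, hu₃.trans (add_le_add hle.1 hle.2), h⟩

theorem hexagon_mono (hL : L ≤ L') (ht : t ≤ t') : hexagon p L t ⊆ hexagon p L' t' :=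
  fun _ hu => ⟨hu.1.trans hL, hu.2.1.trans hL, hu.2.2.trans ht⟩

theorem ordConnected_hexagon : (hexagon p L t).OrdConnected := by
  refine ⟨fun u hu v hv w hw => ?_⟩
  rw [mem_hexagon_iff] at *
  obtain ⟨⟨h₁, h₂⟩, h₃, h₄⟩ := hw
  obtain ⟨⟨hu₁, -⟩, ⟨hu₂, -⟩, hu₃, -⟩ := hu
  obtain ⟨⟨-, hv₁⟩, ⟨-, hv₂⟩, -, hv₃⟩ := hv
  exact ⟨⟨hu₁.trans h₁, h₃.trans hv₁⟩, ⟨hu₂.trans h₂, h₄.trans hv₂⟩,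
    hu₃.trans (add_le_add h₁ h₂), (add_le_add h₃ h₄).trans hv₃⟩

theorem antidiagonal_mem_hexagon {α : ℝ} (hα : |α| ≤ L) (ht : 0 ≤ t) :
    (p.1 + α, p.2 - α) ∈ hexagon p L t := by
  rw [abs_le] at hα
  exact mem_hexagon_iff.2 ⟨⟨by linarith, by linarith⟩, ⟨by linarith, by linarith⟩,
    by linarith, by linarith⟩

theorem antidiagonal_sup_mem_hexagon {α β : ℝ} (hα : |α| ≤ L) (hβ : |β| ≤ L) (h : |β - α| ≤ t) :
    (p.1 + α, p.2 - α) ⊔ (p.1 + β, p.2 - β) ∈ hexagon p L t := by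
  have ht : 0 ≤ t := (abs_nonneg _).trans h
  refine sup_mem_hexagon (antidiagonal_mem_hexagon hα ht) (antidiagonal_mem_hexagon hβ ht) ?_
  change max (p.1 + α) (p.1 + β) + max (p.2 - α) (p.2 - β) ≤ p.1 + p.2 + t
  rw [max_add_add_left, max_sub_sub_left]
  rw [abs_le] at h
  rcases le_total α β with h' | h'
  · rw [max_eq_right h', min_eq_left h']
    linarith
  · rw [max_eq_left h', min_eq_right h']
    linarith

theorem center_mem_hexagon (hL : 0 ≤ L) (ht : 0 ≤ t) : p ∈ hexagon p L t := by
  simpa only [add_zero, sub_zero] using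
    antidiagonal_mem_hexagon (p := p) (by rwa [abs_zero] : |(0 : ℝ)| ≤ L) ht

theorem isConnected_hexagon (hL : 0 ≤ L) (ht : 0 < t) :
    CategoryTheory.IsConnected (hexagon p L t) := by
  have : Nonempty (hexagon p L t) := ⟨⟨p, center_mem_hexagon hL ht.le⟩⟩
  let diag (α : Icc (-L) L) : hexagon p L t :=
    ⟨(p.1 + α, p.2 - α), antidiagonal_mem_hexagon (abs_le.2 α.2) ht.le⟩
  have hproj (u : hexagon p L t) : ∃ α, Zigzag u (diag α) := by
    obtain ⟨⟨h₁, h₂⟩, ⟨h₃, h₄⟩, -⟩ := mem_hexagon_iff.1 u.2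
    refine ⟨⟨(u.1.1 - p.1 - (u.1.2 - p.2)) / 2, by linarith, by linarith⟩, ?_⟩
    rcases le_total 0 (u.1.1 - p.1 + (u.1.2 - p.2)) with h | h
    · exact (zigzag_of_le (Prod.mk_le_mk.2 ⟨by dsimp only; linarith, by dsimp only; linarith⟩)).symm
    · exact zigzag_of_le (Prod.mk_le_mk.2 ⟨by dsimp only; linarith, by dsimp only; linarith⟩)
  have hdiag (α β : Icc (-L) L) : Zigzag (diag α) (diag β) := by
    have : PreconnectedSpace (Icc (-L) L) := Subtype.preconnectedSpace isPreconnected_Icc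
    have : Std.Symm fun α β => Zigzag (diag α) (diag β) := ⟨fun _ _ h => h.symm⟩
    refine PreconnectedSpace.induction₂ (fun α β => Zigzag (diag α) (diag β)) (fun α => ?_)
      ⟨fun _ _ _ h h' => h.trans h'⟩ α β
    filter_upwards [Metric.closedBall_mem_nhds α ht] with β hβ
    rw [Metric.mem_closedBall, Subtype.dist_eq, Real.dist_eq] at hβ
    have hmem := antidiagonal_sup_mem_hexagon (p := p) (abs_le.2 α.2) (abs_le.2 β.2) hβ
    let m : hexagon p L t := ⟨_, hmem⟩
    have hα : diag α ≤ m := show (diag α : ℝ × ℝ) ≤ (diag α : ℝ × ℝ) ⊔ diag β from le_sup_left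
    have hβ' : diag β ≤ m := show (diag β : ℝ × ℝ) ≤ (diag α : ℝ × ℝ) ⊔ diag β from le_sup_right
    exact (zigzag_of_le hα).trans (zigzag_of_le hβ').symm
  refine zigzag_isConnected fun u v => ?_
  obtain ⟨α, hα⟩ := hproj u
  obtain ⟨β, hβ⟩ := hproj v
  exact hα.trans ((hdiag α β).trans hβ.symm)

end Hexagon

section Stability

variable {F : Type u} [Field F] {V : Type v} [LinearOrder V] {q : ℕ}
  {X : PreAbstractSimplicialComplex V} [Finite X.faces] {f f' : X.faces → ℝ × ℝ} {p : ℝ × ℝ}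
  {L L' t t' ε : ℝ}

theorem add_mem_hexagon {u d : ℝ × ℝ} (hu : u ∈ hexagon p L t) (hd₁ : |d.1| ≤ ε) (hd₂ : |d.2| ≤ ε) :
    u + d ∈ hexagon p (L + ε) (t + 2 * ε) := by
  rw [mem_hexagon_iff] at hu ⊢
  rw [abs_le] at hd₁ hd₂
  obtain ⟨⟨h₁, h₂⟩, ⟨h₃, h₄⟩, h₅, h₆⟩ := hu
  rw [Prod.fst_add, Prod.snd_add]
  exact ⟨⟨by linarith, by linarith⟩, ⟨by linarith, by linarith⟩, by linarith, by linarith⟩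

theorem genRank_hexagon_le_of_dist_le [CategoryTheory.IsConnected (hexagon p L t)]
    [CategoryTheory.IsConnected (hexagon p L' t')] (hε : 0 ≤ ε)
    (hL : L' + ε ≤ L) (ht : t' + 2 * ε ≤ t) (hff' : ∀ σ, dist (f σ) (f' σ) ≤ ε) :
    genRank (persistenceModule F q X f) (hexagon p L t) ≤
      genRank (persistenceModule F q X f') (hexagon p L' t') := by
  let shift (c : Icc (-ε) ε) (u : hexagon p L' t') : hexagon p L t :=
    ⟨u + ((c : ℝ), (c : ℝ)),
      hexagon_mono hL ht (add_mem_hexagon u.2 (abs_le.2 c.2) (abs_le.2 c.2))⟩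
  have hshift (c) : Monotone (shift c) := fun u v huv =>
    add_le_add_left (show (u : ℝ × ℝ) ≤ v from huv) _
  have hε' : -ε ≤ ε := neg_le_self hε
  have hmono (S : Set (ℝ × ℝ)) : Monotone (S.domRestrict (sublevel X f)) := fun _ _ h =>
    sublevel_mono X f h
  have hdist (σ) : |(f σ).1 - (f' σ).1| ≤ ε ∧ |(f σ).2 - (f' σ).2| ≤ ε := by
    simpa only [Prod.dist_eq, Real.dist_eq, max_le_iff] using hff' σ
  refine genRank_persistenceModule_le F q (a := shift ⟨-ε, le_rfl, hε'⟩)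
    (b := shift ⟨ε, hε', le_rfl⟩) (j := Classical.arbitrary _)
    (.of_monotone (hmono _) (hshift _) fun u => ?_)
    (.of_monotone (hmono _) (hshift _) fun u => ?_) ?_
  · refine sublevel_le_sublevel fun τ hτ => ?_
    have h := abs_le.1 (hdist τ).1
    have h' := abs_le.1 (hdist τ).2
    have hτ₁ : (f τ).1 ≤ u.1.1 + -ε := hτ.1
    have hτ₂ : (f τ).2 ≤ u.1.2 + -ε := hτ.2
    exact ⟨by linarith, by linarith⟩
  · refine sublevel_le_sublevel fun τ hτ => ?_
    have h := abs_le.1 (hdist τ).1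
    have h' := abs_le.1 (hdist τ).2
    exact ⟨show (f τ).1 ≤ u.1.1 + ε by linarith [hτ.1], show (f τ).2 ≤ u.1.2 + ε by linarith [hτ.2]⟩
  · exact add_le_add_right (show ((-ε, -ε) : ℝ × ℝ) ≤ (ε, ε) from ⟨hε', hε'⟩) _

end Stability

section Growth

variable {P : Type*} [Preorder P] {K : ℝ × ℝ → P} {p u : ℝ × ℝ} {L L' t t' θ : ℝ}

/-- The hexagon of half-width `t + θ` without its part below the strip of half-width `t`. -/
def upperHexagon (p : ℝ × ℝ) (L t θ : ℝ) : Set (ℝ × ℝ) :=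
  {u ∈ hexagon p L (t + θ) | p.1 + p.2 - t ≤ u.1 + u.2}

theorem sub_mem_hexagon_of_mem_upperHexagon (hθt : θ ≤ t)
    (hu : u ∈ upperHexagon p L t θ) (hlt : p.1 + p.2 + t < u.1 + u.2) :
    u - (θ, θ) ∈ hexagon p L t := by
  obtain ⟨hu, -⟩ := hu
  rw [mem_hexagon_iff] at hu ⊢
  rw [Prod.fst_sub, Prod.snd_sub]
  obtain ⟨⟨-, h₂⟩, ⟨-, h₄⟩, -, h₆⟩ := hu
  exact ⟨⟨by linarith, by linarith⟩, ⟨by linarith, by linarith⟩, by linarith, by linarith⟩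

theorem sup_sub_fst_add_snd_le {v : ℝ × ℝ} {c : ℝ} (hθ : 0 ≤ θ) (huv : u ≤ v) (hu : u.1 + u.2 ≤ c)
    (hv : v.1 + v.2 ≤ c + θ) : (u ⊔ (v - (θ, θ))).1 + (u ⊔ (v - (θ, θ))).2 ≤ c := by
  obtain ⟨h₁, h₂⟩ := huv
  change max u.1 (v.1 - θ) + max u.2 (v.2 - θ) ≤ c
  rcases max_choice u.1 (v.1 - θ) with h | h <;> rcases max_choice u.2 (v.2 - θ) with h' | h' <;>
    rw [h, h'] <;> linarith

open Classical in
theorem exists_lowerTransport_upperHexagon (hK : Monotone K) (hθ : 0 ≤ θ) (hθt : θ ≤ t) :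
    ∃ a : upperHexagon p L t θ → hexagon p L t,
      LowerTransport ((hexagon p L t).domRestrict K) ((upperHexagon p L t θ).domRestrict K) a ∧
        ∀ u, u.1 ∈ hexagon p L t → (a u).1 = u := by
  have hmem (u : upperHexagon p L t θ) :
      (if p.1 + p.2 + t < u.1.1 + u.1.2 then (u : ℝ × ℝ) - (θ, θ) else u) ∈ hexagon p L t := by
    split_ifs with h
    · exact sub_mem_hexagon_of_mem_upperHexagon hθt u.2 h
    · obtain ⟨h₁, h₂, -, -⟩ := mem_hexagon_iff.1 u.2.1
      exact mem_hexagon_iff.2 ⟨h₁, h₂, u.2.2, not_lt.1 h⟩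
  let a (u : upperHexagon p L t θ) : hexagon p L t := ⟨_, hmem u⟩
  have ha_of_lt {u : upperHexagon p L t θ} (h : p.1 + p.2 + t < u.1.1 + u.1.2) :
      (a u : ℝ × ℝ) = u - (θ, θ) := if_pos h
  have ha_of_le {u : upperHexagon p L t θ} (h : u.1.1 + u.1.2 ≤ p.1 + p.2 + t) :
      (a u : ℝ × ℝ) = u := if_neg h.not_gt
  have hsub (u : ℝ × ℝ) : u - (θ, θ) ≤ u := sub_le_self u ⟨hθ, hθ⟩
  have hle (u) : (a u : ℝ × ℝ) ≤ u := by
    rcases lt_or_ge (p.1 + p.2 + t) (u.1.1 + u.1.2) with h | h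
    · exact (ha_of_lt h).trans_le (hsub u)
    · exact (ha_of_le h).le
  refine ⟨a, .of_fence (fun _ _ h => hK h) (fun u => hK (hle u)) fun u v huv => ?_,
    fun u hu => ha_of_le (mem_hexagon_iff.1 hu).2.2.2⟩
  have huv' : (u : ℝ × ℝ) ≤ v := huv
  suffices hsup : (a u : ℝ × ℝ) ⊔ a v ∈ hexagon p L t by
    have hu : a u ≤ ⟨_, hsup⟩ := show (a u : ℝ × ℝ) ≤ (a u : ℝ × ℝ) ⊔ a v from le_sup_left
    have hv : a v ≤ ⟨_, hsup⟩ := show (a v : ℝ × ℝ) ≤ (a u : ℝ × ℝ) ⊔ a v from le_sup_right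
    exact ⟨_, _, hu, hv, le_rfl, hK (sup_le ((hle u).trans huv') (hle v))⟩
  refine sup_mem_hexagon (a u).2 (a v).2 ?_
  have hv := (mem_hexagon_iff.1 v.2.1).2.2.2
  rcases lt_or_ge (p.1 + p.2 + t) (v.1.1 + v.1.2) with hv' | hv'
  · rcases lt_or_ge (p.1 + p.2 + t) (u.1.1 + u.1.2) with hu' | hu'
    · have hav : (a u : ℝ × ℝ) ≤ a v := by
        rw [ha_of_lt hu', ha_of_lt hv']
        exact sub_le_sub_right huv' _
      rw [sup_of_le_right hav]
      exact (mem_hexagon_iff.1 (a v).2).2.2.2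
    · rw [ha_of_le hu', ha_of_lt hv']
      exact sup_sub_fst_add_snd_le hθ huv' hu' (by linarith)
  · rw [ha_of_le hv', sup_of_le_right ((hle u).trans huv')]
    exact hv'

theorem add_mem_upperHexagon {d : ℝ × ℝ} (hθt : θ ≤ t)
    (hu : u ∈ hexagon p L (t + θ)) (hlt : u.1 + u.2 < p.1 + p.2 - t)
    (hd : d ∈ ({(θ, 0), (0, θ)} : Set (ℝ × ℝ))) : u + d ∈ upperHexagon p L t θ := by
  obtain ⟨⟨h₁, -⟩, ⟨h₃, -⟩, h₅, -⟩ := mem_hexagon_iff.1 hu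
  rw [upperHexagon, mem_ofPred_eq, mem_hexagon_iff, Prod.fst_add, Prod.snd_add]
  rcases hd with rfl | rfl <;> dsimp only <;>
    exact ⟨⟨⟨by linarith, by linarith⟩, ⟨by linarith, by linarith⟩, by linarith, by linarith⟩,
      by linarith⟩

theorem inf_add_mem_upperHexagon {v : ℝ × ℝ} (hθ : 0 ≤ θ) (hu : u ∈ hexagon p L (t + θ))
    (hv : v ∈ upperHexagon p L t θ) (huv : u ≤ v) : v ⊓ (u + (θ, θ)) ∈ upperHexagon p L t θ := by
  have hle : u ≤ u + (θ, θ) := le_add_of_nonneg_right ⟨hθ, hθ⟩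
  refine ⟨ordConnected_hexagon.out hu hv.1 ⟨le_inf huv hle, inf_le_left⟩, ?_⟩
  have hu' := (mem_hexagon_iff.1 hu).2.2.1
  have hv' := hv.2
  obtain ⟨h₁, h₂⟩ := huv
  change _ ≤ min v.1 (u.1 + θ) + min v.2 (u.2 + θ)
  rcases min_choice v.1 (u.1 + θ) with h | h <;> rcases min_choice v.2 (u.2 + θ) with h' | h' <;>
    rw [h, h'] <;> linarith

theorem exists_fence {d v : ℝ × ℝ} (hK : Monotone K) (hθ : 0 ≤ θ) (hθt : θ ≤ t)
    (hu : u ∈ hexagon p L (t + θ)) (hlt : u.1 + u.2 < p.1 + p.2 - t)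
    (hd : d ∈ ({(θ, 0), (0, θ)} : Set (ℝ × ℝ)))
    (hcell : ∀ w ∈ Icc u (u + (θ, θ)), K (w ⊔ (u + d)) ≤ K w)
    (hv : v ∈ upperHexagon p L t θ) (huv : u ≤ v) :
    ∃ m ∈ upperHexagon p L t θ, ∃ m' ∈ upperHexagon p L t θ,
      u + d ≤ m ∧ m' ≤ m ∧ m' ≤ v ∧ K m ≤ K v := by
  have hd' : d ≤ (θ, θ) := by
    rcases hd with rfl | rfl
    exacts [⟨le_rfl, hθ⟩, ⟨hθ, le_rfl⟩]
  have hw := inf_add_mem_upperHexagon hθ hu hv huv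
  have hx := add_mem_upperHexagon hθt hu hlt hd
  set w := v ⊓ (u + (θ, θ))
  have hwu : w ⊔ (u + d) ≤ u + (θ, θ) := sup_le inf_le_right (add_le_add_right hd' u)
  have hsum : (w ⊔ (u + d)).1 + (w ⊔ (u + d)).2 ≤ u.1 + θ + (u.2 + θ) := add_le_add hwu.1 hwu.2
  have hwsup : w ≤ w ⊔ (u + d) := le_sup_left
  refine ⟨w ⊔ (u + d), ⟨sup_mem_hexagon hw.1 hx.1 (by linarith), ?_⟩, w, hw, le_sup_right, hwsup,
    inf_le_left, (hcell w ⟨le_inf huv ?_, inf_le_right⟩).trans (hK inf_le_left)⟩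
  · exact hw.2.trans (add_le_add hwsup.1 hwsup.2)
  · exact le_add_of_nonneg_right ⟨hθ, hθ⟩

theorem exists_lowerTransport_of_cells (hK : Monotone K) (hθ : 0 ≤ θ) (hθt : θ ≤ t)
    (hcell : ∀ u ∈ hexagon p L (t + θ), u.1 + u.2 < p.1 + p.2 - t →
      ∃ d ∈ ({(θ, 0), (0, θ)} : Set (ℝ × ℝ)), ∀ w ∈ Icc u (u + (θ, θ)), K (w ⊔ (u + d)) ≤ K w) :
    ∃ a : hexagon p L (t + θ) → upperHexagon p L t θ,
      LowerTransport ((upperHexagon p L t θ).domRestrict K)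
        ((hexagon p L (t + θ)).domRestrict K) a ∧
      ∀ u, u.1 ∈ upperHexagon p L t θ → (a u).1 = u := by
  have hex (u : hexagon p L (t + θ)) : ∃ x : upperHexagon p L t θ, u.1 ≤ x ∧ K x ≤ K u ∧
      (u.1 ∈ upperHexagon p L t θ → x.1 = u) ∧
      ∀ v : upperHexagon p L t θ, u.1 ≤ v → ∃ m m', x ≤ m ∧ m' ≤ m ∧ m' ≤ v ∧ K m ≤ K v := by
    rcases lt_or_ge (u.1.1 + u.1.2) (p.1 + p.2 - t) with hlt | hge
    · obtain ⟨d, hd, hw⟩ := hcell u u.2 hlt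
      have hle : u.1 ≤ u.1 + d := le_add_of_nonneg_right <| by
        rcases hd with rfl | rfl
        exacts [⟨hθ, le_rfl⟩, ⟨le_rfl, hθ⟩]
      refine ⟨⟨u + d, add_mem_upperHexagon hθt u.2 hlt hd⟩, hle, ?_,
        fun h => absurd h.2 hlt.not_ge, fun v huv => ?_⟩
      · simpa only [sup_of_le_right hle] using
          hw u ⟨le_rfl, le_add_of_nonneg_right ⟨hθ, hθ⟩⟩
      · obtain ⟨m, hm, m', hm', h⟩ := exists_fence hK hθ hθt u.2 hlt hd hw v.2 huv
        exact ⟨⟨m, hm⟩, ⟨m', hm'⟩, h⟩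
    · exact ⟨⟨u, u.2, hge⟩, le_rfl, le_rfl, fun _ => rfl, fun v huv => ⟨v, v, huv, le_rfl, le_rfl,
        le_rfl⟩⟩
  choose a hle hKa hfix hfence using hex
  refine ⟨a, .of_fence (fun _ _ h => hK h) hKa fun u v huv => ?_, hfix⟩
  obtain ⟨m, m', h₁, h₂, h₃, h₄⟩ := hfence u (a v) ((show u.1 ≤ v from huv).trans (hle v))
  exact ⟨m, m', h₁, h₂, h₃, h₄.trans (hKa v)⟩

/-- The nearest point to `u` in the square of radius `L` around `p`. -/
def clamp (p : ℝ × ℝ) (L : ℝ) (u : ℝ × ℝ) : ℝ × ℝ :=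
  (p - (L, L)) ⊔ ((p + (L, L)) ⊓ u)

theorem monotone_clamp : Monotone (clamp p L) :=
  fun _ _ h => sup_le_sup_left (inf_le_inf_left _ h) _

theorem clamp_self (hL : 0 ≤ L) : clamp p L p = p := by
  have h : (0 : ℝ × ℝ) ≤ (L, L) := ⟨hL, hL⟩
  rw [clamp, inf_of_le_right (le_add_of_nonneg_right h), sup_of_le_right (sub_le_self p h)]

theorem clamp_sub (hL : 0 ≤ L) : clamp p L (p + p - u) = p + p - clamp p L u := by
  ext
  · change max (p.1 - L) (min (p.1 + L) (p.1 + p.1 - u.1)) =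
      p.1 + p.1 - max (p.1 - L) (min (p.1 + L) u.1)
    grind
  · change max (p.2 - L) (min (p.2 + L) (p.2 + p.2 - u.2)) =
      p.2 + p.2 - max (p.2 - L) (min (p.2 + L) u.2)
    grind

theorem clamp_mem_hexagon (hL : 0 ≤ L) (hLL' : L ≤ L') (ht : t' + 2 * (L' - L) ≤ t)
    (hu : u ∈ hexagon p L' t') : clamp p L u ∈ hexagon p L t := by
  rw [mem_hexagon_iff] at hu ⊢
  change ((_ ≤ max (p.1 - L) (min (p.1 + L) u.1) ∧ max (p.1 - L) (min (p.1 + L) u.1) ≤ _) ∧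
    (_ ≤ max (p.2 - L) (min (p.2 + L) u.2) ∧ max (p.2 - L) (min (p.2 + L) u.2) ≤ _) ∧
    _ ≤ max (p.1 - L) (min (p.1 + L) u.1) + max (p.2 - L) (min (p.2 + L) u.2) ∧
    max (p.1 - L) (min (p.1 + L) u.1) + max (p.2 - L) (min (p.2 + L) u.2) ≤ _)
  grind

theorem exists_lowerTransport_hexagon (hK : Monotone K) (hθ : 0 ≤ θ) (hθt : θ ≤ t) (hL : 0 ≤ L)
    (hLL' : L ≤ L') (ht : t' + 2 * (L' - L) ≤ t + θ)
    (hcell : ∀ u ∈ hexagon p L (t + θ), u.1 + u.2 < p.1 + p.2 - t →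
      ∃ d ∈ ({(θ, 0), (0, θ)} : Set (ℝ × ℝ)), ∀ w ∈ Icc u (u + (θ, θ)), K (w ⊔ (u + d)) ≤ K w)
    (hclamp : ∀ u ∈ hexagon p L' t', K (clamp p L u) ≤ K u) :
    ∃ a : hexagon p L' t' → hexagon p L t,
      LowerTransport ((hexagon p L t).domRestrict K) ((hexagon p L' t').domRestrict K) a ∧
        ∀ u, u.1 = p → (a u).1 = p := by
  obtain ⟨a, ha, hfix⟩ := exists_lowerTransport_upperHexagon (p := p) (L := L) hK hθ hθt
  obtain ⟨a', ha', hfix'⟩ := exists_lowerTransport_of_cells hK hθ hθt hcell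
  let c (u : hexagon p L' t') : hexagon p L (t + θ) := ⟨_, clamp_mem_hexagon hL hLL' ht u.2⟩
  have hc : LowerTransport ((hexagon p L (t + θ)).domRestrict K)
      ((hexagon p L' t').domRestrict K) c :=
    .of_monotone (fun _ _ h => hK h) (fun _ _ h => monotone_clamp h) fun u => hclamp u u.2
  refine ⟨a ∘ a' ∘ c, ha.trans (ha'.trans hc), fun u hu => ?_⟩
  have ht₀ : 0 ≤ t := hθ.trans hθt
  have hcu : (c u).1 = p := (congrArg (clamp p L) hu).trans (clamp_self hL)
  have hp : p ∈ upperHexagon p L t θ :=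
    ⟨center_mem_hexagon hL (add_nonneg ht₀ hθ), sub_le_self _ ht₀⟩
  have ha'u : (a' (c u)).1 = p := (hfix' _ (hcu.symm ▸ hp)).trans hcu
  have hp' : (a' (c u)).1 ∈ hexagon p L t := ha'u.symm ▸ center_mem_hexagon hL ht₀
  exact (hfix _ hp').trans ha'u

theorem sub_mem_hexagon : u ∈ hexagon p L t → p + p - u ∈ hexagon p L t := by
  simp only [mem_hexagon_iff, Prod.fst_add, Prod.snd_add, Prod.fst_sub, Prod.snd_sub]
  rintro ⟨⟨h₁, h₂⟩, ⟨h₃, h₄⟩, h₅, h₆⟩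
  exact ⟨⟨by linarith, by linarith⟩, ⟨by linarith, by linarith⟩, by linarith, by linarith⟩

open OrderDual in
theorem exists_upperTransport_hexagon (hK : Monotone K) (hθ : 0 ≤ θ) (hθt : θ ≤ t) (hL : 0 ≤ L)
    (hLL' : L ≤ L') (ht : t' + 2 * (L' - L) ≤ t + θ)
    (hcell : ∀ u ∈ hexagon p L (t + θ), p.1 + p.2 + t < u.1 + u.2 →
      ∃ d ∈ ({(θ, 0), (0, θ)} : Set (ℝ × ℝ)), ∀ w ∈ Icc (u - (θ, θ)) u, K w ≤ K (w ⊓ (u - d)))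
    (hclamp : ∀ u ∈ hexagon p L' t', K u ≤ K (clamp p L u)) :
    ∃ b : hexagon p L' t' → hexagon p L t,
      UpperTransport ((hexagon p L t).domRestrict K) ((hexagon p L' t').domRestrict K) b ∧
        ∀ u, u.1 = p → (b u).1 = p := by
  let e (L t : ℝ) (u : hexagon p L t) : hexagon p L t := ⟨p + p - u, sub_mem_hexagon u.2⟩
  have he (L t) : Antitone (e L t) := fun u v huv =>
    sub_le_sub_left (show u.1 ≤ v from huv) (p + p)
  have hinv (L t) : Function.Involutive (e L t) := fun u => Subtype.ext (sub_sub_cancel _ _)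
  have hK' : Monotone fun u => toDual (K (p + p - u)) := fun u v huv =>
    toDual_le_toDual.2 (hK (sub_le_sub_left huv _))
  have hcell' (u : ℝ × ℝ) (hu : u ∈ hexagon p L (t + θ)) (hlt : u.1 + u.2 < p.1 + p.2 - t) :
      ∃ d ∈ ({(θ, 0), (0, θ)} : Set (ℝ × ℝ)), ∀ w ∈ Icc u (u + (θ, θ)),
        toDual (K (p + p - (w ⊔ (u + d)))) ≤ toDual (K (p + p - w)) := by
    obtain ⟨d, hd, h⟩ := hcell (p + p - u) (sub_mem_hexagon hu) (by
      simp only [Prod.fst_add, Prod.snd_add, Prod.fst_sub, Prod.snd_sub]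
      linarith)
    refine ⟨d, hd, fun w hw => ?_⟩
    have h' := h (p + p - w) ⟨?_, sub_le_sub_left hw.1 _⟩
    · rwa [sub_sub, ← sub_sup] at h'
    · rw [sub_sub]
      exact sub_le_sub_left hw.2 _
  have hclamp' (u : ℝ × ℝ) (hu : u ∈ hexagon p L' t') :
      toDual (K (p + p - clamp p L u)) ≤ toDual (K (p + p - u)) := by
    rw [← clamp_sub hL]
    exact hclamp _ (sub_mem_hexagon hu)
  obtain ⟨a, ha, hfix⟩ := exists_lowerTransport_hexagon hK' hθ hθt hL hLL' ht hcell' hclamp'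
  refine ⟨_, ha.reflect (he L t) (he L' t') (hinv L' t'), fun u hu => ?_⟩
  have hp : p + p - p = p := add_sub_cancel_right p p
  change p + p - (a (e L' t' u)).1 = p
  rw [hfix _ ((congrArg (p + p - ·) hu).trans hp), hp]

end Growth

section Avoidance

variable {ι : Type*} {p : ℝ × ℝ} {L L' t t' θ η : ℝ}

theorem JoinOn.mono {E E' : Set (ℝ × ℝ)} (hE : E ⊆ E') {f : ι → ℝ × ℝ} {σ τ : ι}
    (h : JoinOn E f σ τ) : JoinOn E' f σ τ :=
  ⟨hE h.1, h.2⟩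

theorem fst_le_or_snd_le_or_joinOn [Finite ι] (f : ι → ℝ × ℝ) (z b : ℝ × ℝ) :
    (∀ τ, f τ ≤ b → (f τ).1 ≤ z.1) ∨ (∀ τ, f τ ≤ b → (f τ).2 ≤ z.2) ∨
      ∃ σ τ, JoinOn (Ioc z.1 b.1 ×ˢ Ioc z.2 b.2) f σ τ := by
  rcases {τ | f τ ≤ b}.eq_empty_or_nonempty with hempty | hne
  · exact .inl fun τ hτ => absurd hτ (eq_empty_iff_forall_notMem.1 hempty τ)
  obtain ⟨τ, hτ, hτmax⟩ := exists_max_image _ (fun τ => (f τ).1) (toFinite {τ | f τ ≤ b}) hne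
  obtain ⟨σ, hσ, hσmax⟩ := exists_max_image _ (fun τ => (f τ).2) (toFinite {τ | f τ ≤ b}) hne
  rcases le_or_gt (f τ).1 z.1 with h₁ | h₁
  · exact .inl fun ρ hρ => (hτmax ρ hρ).trans h₁
  rcases le_or_gt (f σ).2 z.2 with h₂ | h₂
  · exact .inr (.inl fun ρ hρ => (hσmax ρ hρ).trans h₂)
  refine .inr (.inr ⟨σ, τ, ⟨?_, ?_⟩, hτmax σ hσ, hσmax τ hτ⟩)
  · rw [Prod.fst_sup, sup_of_le_right (hτmax σ hσ)]
    exact ⟨h₁, hτ.1⟩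
  · rw [Prod.snd_sup, sup_of_le_left (hσmax τ hτ)]
    exact ⟨h₂, hσ.2⟩

/-- The `η`-neighbourhood of the two off-diagonal edges of a hexagon. -/
def edgeCollar (p : ℝ × ℝ) (L t η : ℝ) : Set (ℝ × ℝ) :=
  {u | |u.1 - p.1| ≤ L + η ∧ |u.2 - p.2| ≤ L + η ∧ |(|u.1 - p.1 + (u.2 - p.2)| - t)| ≤ η}

/-- No value of `f` has a coordinate which is `η`-aligned with an axis-parallel edge of the hexagon,
and no join of values of `f` is `η`-close to an off-diagonal edge. -/
def AvoidsBoundary (f : ι → ℝ × ℝ) (p : ℝ × ℝ) (L t η : ℝ) : Prop :=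
  (∀ σ, η < |(|(f σ).1 - p.1| - L)| ∧ η < |(|(f σ).2 - p.2| - L)|) ∧
    ∀ σ τ, ¬ JoinOn (edgeCollar p L t η) f σ τ

theorem eventually_notMem_edgeCollar {u : ℝ × ℝ} (hu : u ∉ edgeCollar p L t η) :
    ∀ᶠ η' in 𝓝 η, u ∉ edgeCollar p L t η' := by
  have hclosed : IsClosed {η' | u ∈ edgeCollar p L t η'} :=
    (isClosed_le (f := fun _ => |u.1 - p.1|) (by fun_prop) (by fun_prop)).inter
      ((isClosed_le (f := fun _ => |u.2 - p.2|) (by fun_prop) (by fun_prop)).inter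
        (isClosed_le (f := fun _ => |(|u.1 - p.1 + (u.2 - p.2)| - t)|) (by fun_prop)
          (by fun_prop)))
  exact hclosed.isOpen_compl.mem_nhds hu

theorem AvoidsBoundary.eventually [Finite ι] {f : ι → ℝ × ℝ} (hf : AvoidsBoundary f p L t η) :
    ∀ᶠ η' in 𝓝 η, AvoidsBoundary f p L t η' := by
  simp only [AvoidsBoundary, eventually_and, eventually_all]
  refine ⟨fun σ => ⟨eventually_lt_nhds (hf.1 σ).1, eventually_lt_nhds (hf.1 σ).2⟩,
    fun σ τ => ?_⟩
  by_cases h : f σ ⊔ f τ ∈ edgeCollar p L t η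
  · exact .of_forall fun η' h' => hf.2 σ τ ⟨h, h'.2⟩
  · exact (eventually_notMem_edgeCollar h).mono fun η' hη' h' => hη' h'.1

theorem edgeCollar_subset_edgeCollar {η' : ℝ} (hL : |L - L'| + η ≤ η') (ht : |t - t'| + η ≤ η') :
    edgeCollar p L t η ⊆ edgeCollar p L' t' η' := by
  rintro u ⟨h₁, h₂, h₃⟩
  have hL' := le_abs_self (L - L')
  exact ⟨by linarith, by linarith,
    (abs_sub_le _ t t').trans ((add_comm _ _).trans_le ((add_le_add_right h₃ _).trans ht))⟩

theorem AvoidsBoundary.mono {η' : ℝ} {f : ι → ℝ × ℝ} (hf : AvoidsBoundary f p L' t' η')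
    (hL : |L - L'| + η ≤ η') (ht : |t - t'| + η ≤ η') : AvoidsBoundary f p L t η := by
  have hlt {c : ℝ} (hc : η' < |c - L'|) : η < |c - L| := by
    linarith [abs_sub_le c L L']
  exact ⟨fun σ => ⟨hlt (hf.1 σ).1, hlt (hf.1 σ).2⟩,
    fun σ τ h => hf.2 σ τ (h.mono (edgeCollar_subset_edgeCollar hL ht))⟩

theorem le_max_min_iff {c x y : ℝ} (hL : 0 ≤ L) (hx : |x - y| ≤ L') (hLL' : L' ≤ L + η)
    (hc : η < |(|c - y| - L)|) : c ≤ max (y - L) (min (y + L) x) ↔ c ≤ x := by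
  rw [abs_le] at hx
  rw [le_max_iff, le_min_iff]
  rcases lt_abs.1 hc with hfar | hnear
  · rcases lt_abs.1 (show L + η < |c - y| by linarith) with h | h
    · grind
    · grind
  · grind

theorem AvoidsBoundary.le_clamp_iff {f : ι → ℝ × ℝ} (hf : AvoidsBoundary f p L t η) (hL : 0 ≤ L)
    (hLL' : L' ≤ L + η) {u : ℝ × ℝ} (hu : u ∈ hexagon p L' t') (σ : ι) :
    f σ ≤ clamp p L u ↔ f σ ≤ u :=
  and_congr (le_max_min_iff hL hu.1 hLL' (hf.1 σ).1) (le_max_min_iff hL hu.2.1 hLL' (hf.1 σ).2)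

theorem closedBall_subset_edgeCollar {u : ℝ × ℝ} (hθ : 0 ≤ θ) (hη : 3 * θ ≤ η)
    (hu : u ∈ hexagon p L (t + θ)) (hut : t < |u.1 - p.1 + (u.2 - p.2)|) :
    Metric.closedBall u θ ⊆ edgeCollar p L t η := by
  rintro w hw
  obtain ⟨hw₁, hw₂⟩ : |w.1 - u.1| ≤ θ ∧ |w.2 - u.2| ≤ θ := by
    simpa only [Metric.mem_closedBall, Prod.dist_eq, Real.dist_eq, max_le_iff] using hw
  have hsum := (abs_abs_sub_abs_le (w.1 - p.1 + (w.2 - p.2)) (u.1 - p.1 + (u.2 - p.2))).trans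
    (show |_| ≤ 2 * θ by
      rw [show w.1 - p.1 + (w.2 - p.2) - (u.1 - p.1 + (u.2 - p.2)) = w.1 - u.1 + (w.2 - u.2) by
        ring]
      linarith [abs_add_le (w.1 - u.1) (w.2 - u.2)])
  rw [abs_le] at hsum
  refine ⟨(abs_sub_le _ u.1 _).trans (by linarith [hu.1]),
    (abs_sub_le _ u.2 _).trans (by linarith [hu.2.1]), abs_le.2 ⟨?_, ?_⟩⟩
  · linarith
  · linarith [hu.2.2]

theorem AvoidsBoundary.fst_le_or_snd_le [Finite ι] {f : ι → ℝ × ℝ} (hf : AvoidsBoundary f p L t η)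
    (hθ : 0 ≤ θ) (hη : 3 * θ ≤ η) {u z b : ℝ × ℝ} (hu : u ∈ hexagon p L (t + θ))
    (hut : t < |u.1 - p.1 + (u.2 - p.2)|) (hz : u - (θ, θ) ≤ z) (hb : b ≤ u + (θ, θ)) :
    (∀ τ, f τ ≤ b → (f τ).1 ≤ z.1) ∨ ∀ τ, f τ ≤ b → (f τ).2 ≤ z.2 := by
  have hcell : Ioc z.1 b.1 ×ˢ Ioc z.2 b.2 ⊆ edgeCollar p L t η := by
    refine Subset.trans ?_ (closedBall_subset_edgeCollar hθ hη hu hut)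
    rw [← closedBall_prod_same, Real.closedBall_eq_Icc, Real.closedBall_eq_Icc]
    exact prod_mono (Ioc_subset_Icc_self.trans (Icc_subset_Icc hz.1 hb.1))
      (Ioc_subset_Icc_self.trans (Icc_subset_Icc hz.2 hb.2))
  rcases fst_le_or_snd_le_or_joinOn f z b with h | h | ⟨σ, τ, h⟩
  exacts [.inl h, .inr h, absurd (h.mono hcell) (hf.2 σ τ)]

variable {F : Type u} [Field F] {V : Type v} {q : ℕ} {X : PreAbstractSimplicialComplex V}
  [Finite X.faces] {f : X.faces → ℝ × ℝ}

theorem AvoidsBoundary.exists_lower_cell (hf : AvoidsBoundary f p L t η) (hθ : 0 ≤ θ)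
    (hη : 3 * θ ≤ η) {u : ℝ × ℝ} (hu : u ∈ hexagon p L (t + θ))
    (hlt : u.1 + u.2 < p.1 + p.2 - t) :
    ∃ d ∈ ({(θ, 0), (0, θ)} : Set (ℝ × ℝ)), ∀ w ∈ Icc u (u + (θ, θ)),
      sublevel X f (w ⊔ (u + d)) ≤ sublevel X f w := by
  have hut : t < |u.1 - p.1 + (u.2 - p.2)| := lt_abs.2 (.inr (by linarith))
  have hle {d w : ℝ × ℝ} (hd : d ≤ (θ, θ)) (hw : w ≤ u + (θ, θ)) {τ} (hτ : f τ ≤ w ⊔ (u + d)) :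
      f τ ≤ u + (θ, θ) := hτ.trans (sup_le hw (add_le_add_right hd u))
  rcases hf.fst_le_or_snd_le hθ hη hu hut (sub_le_self u ⟨hθ, hθ⟩) le_rfl with h | h
  · refine ⟨(θ, 0), .inl rfl, fun w hw => sublevel_le_sublevel fun τ hτ => ?_⟩
    refine ⟨(h τ (hle (d := (θ, 0)) ⟨le_rfl, hθ⟩ hw.2 hτ)).trans hw.1.1,
      hτ.2.trans (sup_le le_rfl ?_)⟩
    exact (add_zero u.2).trans_le hw.1.2
  · refine ⟨(0, θ), .inr rfl, fun w hw => sublevel_le_sublevel fun τ hτ => ?_⟩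
    refine ⟨hτ.1.trans (sup_le le_rfl ?_),
      (h τ (hle (d := (0, θ)) ⟨hθ, le_rfl⟩ hw.2 hτ)).trans hw.1.2⟩
    exact (add_zero u.1).trans_le hw.1.1

theorem AvoidsBoundary.exists_upper_cell (hf : AvoidsBoundary f p L t η) (hθ : 0 ≤ θ)
    (hη : 3 * θ ≤ η) {u : ℝ × ℝ} (hu : u ∈ hexagon p L (t + θ))
    (hlt : p.1 + p.2 + t < u.1 + u.2) :
    ∃ d ∈ ({(θ, 0), (0, θ)} : Set (ℝ × ℝ)), ∀ w ∈ Icc (u - (θ, θ)) u,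
      sublevel X f w ≤ sublevel X f (w ⊓ (u - d)) := by
  have hut : t < |u.1 - p.1 + (u.2 - p.2)| := lt_abs.2 (.inl (by linarith))
  rcases hf.fst_le_or_snd_le hθ hη hu hut le_rfl (le_add_of_nonneg_right ⟨hθ, hθ⟩) with h | h
  · refine ⟨(θ, 0), .inl rfl, fun w hw => sublevel_le_sublevel fun τ hτ => le_inf hτ ?_⟩
    have hτu := hτ.trans hw.2
    exact ⟨h τ hτu, hτu.2.trans_eq (sub_zero u.2).symm⟩
  · refine ⟨(0, θ), .inr rfl, fun w hw => sublevel_le_sublevel fun τ hτ => le_inf hτ ?_⟩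
    have hτu := hτ.trans hw.2
    exact ⟨hτu.1.trans_eq (sub_zero u.1).symm, h τ hτu⟩

theorem AvoidsBoundary.genRank_hexagon_le [LinearOrder V]
    [CategoryTheory.IsConnected (hexagon p L t)] [CategoryTheory.IsConnected (hexagon p L' t')]
    (hf : AvoidsBoundary f p L t η) (hθ : 0 ≤ θ) (hη : 3 * θ ≤ η) (hθt : θ ≤ t) (hL : 0 ≤ L)
    (hLL' : L ≤ L') (htt' : t ≤ t') (ht : t' + 2 * (L' - L) ≤ t + θ) :
    genRank (persistenceModule F q X f) (hexagon p L t) ≤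
      genRank (persistenceModule F q X f) (hexagon p L' t') := by
  have hiff {u} (hu : u ∈ hexagon p L' t') := hf.le_clamp_iff hL (by linarith) hu
  obtain ⟨a, ha, hap⟩ := exists_lowerTransport_hexagon (sublevel_mono X f) hθ hθt hL hLL' ht
    (fun u hu => hf.exists_lower_cell hθ hη hu)
    (fun u hu => sublevel_le_sublevel fun τ => (hiff hu τ).1)
  obtain ⟨b, hb, hbp⟩ := exists_upperTransport_hexagon (sublevel_mono X f) hθ hθt hL hLL' ht
    (fun u hu => hf.exists_upper_cell hθ hη hu)
    (fun u hu => sublevel_le_sublevel fun τ => (hiff hu τ).2)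
  let c : hexagon p L' t' := ⟨p, center_mem_hexagon (hL.trans hLL') (by linarith)⟩
  exact genRank_persistenceModule_le F q ha hb (j := c)
    (show (a c).1 ≤ (b c).1 from ((hap c rfl).trans (hbp c rfl).symm).le)

end Avoidance

section Landscape

variable (F : Type u) [Field F] {V : Type v} [LinearOrder V] (q : ℕ)
  (X : PreAbstractSimplicialComplex V) (p : ℝ × ℝ) (k ℓ : ℕ)

/-- The set of worm widths of which `Lam` is the supremum. -/
def rankWidths (f : X.faces → ℝ × ℝ) : Set ℝ :=
  {δ | 0 ≤ δ ∧ ∃ _ : Nonempty (worm p ℓ δ), k ≤ genRank (persistenceModule F q X f) (worm p ℓ δ)}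

theorem Lam_eq_sSup_rankWidths (f : X.faces → ℝ × ℝ) :
    Lam F q X p k ℓ f = sSup (rankWidths F q X p k ℓ f) :=
  rfl

theorem Lam_nonneg (f : X.faces → ℝ × ℝ) : 0 ≤ Lam F q X p k ℓ f :=
  Real.sSup_nonneg fun _ hδ => hδ.1

variable {F q X p k ℓ}

theorem mem_rankWidths_iff (hℓ : 1 ≤ ℓ) {δ : ℝ} (hδ : 0 ≤ δ) {f : X.faces → ℝ × ℝ}
    [Nonempty (hexagon p (ℓ * δ) (2 * δ))] : δ ∈ rankWidths F q X p k ℓ f ↔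
      k ≤ genRank (persistenceModule F q X f) (hexagon p (ℓ * δ) (2 * δ)) := by
  have h := worm_eq_hexagon (p := p) hℓ hδ
  generalize hexagon p (ℓ * δ) (2 * δ) = S at *
  subst h
  exact ⟨fun h => h.2.2, fun h => ⟨hδ, inferInstance, h⟩⟩

theorem mem_upperBounds_rankWidths [Fintype X.faces] (hk : 1 ≤ k) (hℓ : 1 ≤ ℓ)
    (f : X.faces → ℝ × ℝ) : dist f (fun _ => p) ∈ upperBounds (rankWidths F q X p k ℓ f) := by
  intro δ hδ
  by_contra! hlt
  have hδ₀ : 0 < δ := dist_nonneg.trans_lt hlt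
  have := isConnected_hexagon (p := p) (L := ℓ * δ) (t := 2 * δ) (by positivity) (by positivity)
  have hδℓ : δ ≤ ℓ * δ := le_mul_of_one_le_left hδ₀.le (by exact_mod_cast hℓ)
  have hcorner : p - (δ, δ) ∈ hexagon p (ℓ * δ) (2 * δ) := mem_hexagon_iff.2
    ⟨⟨show _ ≤ p.1 - δ by linarith, show p.1 - δ ≤ _ by linarith⟩,
      ⟨show _ ≤ p.2 - δ by linarith, show p.2 - δ ≤ _ by linarith⟩,
      show _ ≤ p.1 - δ + (p.2 - δ) by linarith, show p.1 - δ + (p.2 - δ) ≤ _ by linarith⟩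
  have hzero := genRank_persistenceModule_eq_zero F q (f := f) hcorner fun σ hσ => by
    have h := (dist_le_pi_dist f (fun _ => p) σ).trans_lt hlt
    rw [Prod.dist_eq, max_lt_iff, Real.dist_eq, abs_lt] at h
    have hσ' : (f σ).1 ≤ p.1 - δ := hσ.1
    linarith
  have := (mem_rankWidths_iff hℓ hδ₀.le).1 hδ
  omega

theorem sub_mem_rankWidths [Finite X.faces] (hℓ : 1 ≤ ℓ) {f f' : X.faces → ℝ × ℝ} {δ ε : ℝ}
    (hδ : δ ∈ rankWidths F q X p k ℓ f) (hε : 0 ≤ ε) (hεδ : ε < δ)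
    (hff' : ∀ σ, dist (f σ) (f' σ) ≤ ε) : δ - ε ∈ rankWidths F q X p k ℓ f' := by
  have hδ₀ : 0 < δ := hε.trans_lt hεδ
  have hδε : 0 < δ - ε := sub_pos.2 hεδ
  have := isConnected_hexagon (p := p) (L := ℓ * δ) (t := 2 * δ) (by positivity) (by positivity)
  have := isConnected_hexagon (p := p) (L := ℓ * (δ - ε)) (t := 2 * (δ - ε)) (by positivity)
    (by positivity)
  have hℓε : ε ≤ ℓ * ε := le_mul_of_one_le_left hε (by exact_mod_cast hℓ)
  rw [mem_rankWidths_iff hℓ hδ₀.le] at hδ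
  rw [mem_rankWidths_iff hℓ hδε.le]
  exact hδ.trans (genRank_hexagon_le_of_dist_le hε (by linarith) (by linarith) hff')

theorem lipschitzWith_Lam [Fintype X.faces] (hk : 1 ≤ k) (hℓ : 1 ≤ ℓ) :
    LipschitzWith 1 (Lam F q X p k ℓ) := by
  refine LipschitzWith.of_le_add fun f f' => Real.sSup_le (fun δ hδ => ?_)
    (add_nonneg (Lam_nonneg F q X p k ℓ f') dist_nonneg)
  rcases le_or_gt δ (dist f f') with h | h
  · exact le_add_of_nonneg_of_le (Lam_nonneg F q X p k ℓ f') h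
  · exact sub_le_iff_le_add.1 (le_csSup ⟨_, mem_upperBounds_rankWidths hk hℓ f'⟩
      (sub_mem_rankWidths hℓ hδ dist_nonneg h fun σ => dist_le_pi_dist f f' σ))

theorem AvoidsBoundary.mem_rankWidths [Finite X.faces] (hℓ : 1 ≤ ℓ) {f : X.faces → ℝ × ℝ}
    {δ δ' η : ℝ} (hf : AvoidsBoundary f p (ℓ * δ) (2 * δ) η) (hδ₀ : 0 < δ) (hδδ' : δ ≤ δ')
    (hη : 6 * (ℓ + 1) * (δ' - δ) ≤ η) (hδ' : (ℓ + 1) * (δ' - δ) ≤ δ)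
    (hδ : δ ∈ rankWidths F q X p k ℓ f) : δ' ∈ rankWidths F q X p k ℓ f := by
  have hδ'₀ : 0 < δ' := hδ₀.trans_le hδδ'
  have hgap : 0 ≤ (ℓ + 1) * (δ' - δ) := mul_nonneg (by positivity) (sub_nonneg.2 hδδ')
  have := isConnected_hexagon (p := p) (L := ℓ * δ) (t := 2 * δ) (by positivity) (by positivity)
  have := isConnected_hexagon (p := p) (L := ℓ * δ') (t := 2 * δ') (by positivity) (by positivity)
  rw [mem_rankWidths_iff hℓ hδ₀.le] at hδ
  rw [mem_rankWidths_iff hℓ hδ'₀.le]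
  exact hδ.trans (hf.genRank_hexagon_le (θ := 2 * ((ℓ + 1) * (δ' - δ)))
    (mul_nonneg zero_le_two hgap) (by linarith) (by linarith) (by positivity) (by gcongr)
    (by linarith) (by linarith))

theorem not_avoidsBoundary_Lam [Finite X.faces] (hk : 1 ≤ k) (hℓ : 1 ≤ ℓ)
    {f : X.faces → ℝ × ℝ} (hpos : 0 < Lam F q X p k ℓ f) :
    ¬ AvoidsBoundary f p (ℓ * Lam F q X p k ℓ f) (2 * Lam F q X p k ℓ f) 0 := by
  intro hf
  cases nonempty_fintype X.faces
  have hle {δ} (hδ : δ ∈ rankWidths F q X p k ℓ f) : δ ≤ Lam F q X p k ℓ f :=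
    le_csSup ⟨_, mem_upperBounds_rankWidths hk hℓ f⟩ hδ
  have hne : (rankWidths F q X p k ℓ f).Nonempty := by
    by_contra! h
    exact hpos.ne' (by rw [Lam_eq_sSup_rankWidths, h, Real.sSup_empty])
  set Δ := Lam F q X p k ℓ f
  obtain ⟨η, hη₀, hηΔ, hfη⟩ : ∃ η, 0 < η ∧ η < Δ ∧ AvoidsBoundary f p (ℓ * Δ) (2 * Δ) η :=
    (eventually_mem_nhdsWithin.and ((eventually_nhdsWithin_of_eventually_nhds
      ((eventually_lt_nhds hpos).and hf.eventually)))).exists (f := 𝓝[>] 0)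
  obtain ⟨ε, hε₀, hε⟩ : ∃ ε, 0 < ε ∧ 14 * ((ℓ + 1) * ε) = η :=
    ⟨η / (14 * (ℓ + 1)), by positivity, by field_simp⟩
  obtain ⟨δ, hδ, hΔδ⟩ : ∃ δ ∈ rankWidths F q X p k ℓ f, Δ - ε < δ :=
    exists_lt_of_lt_csSup hne (sub_lt_self Δ hε₀)
  have hℓε : 0 ≤ ℓ * ε := by positivity
  have hℓδ : ℓ * (Δ - δ) ≤ ℓ * ε := by gcongr; linarith
  have hℓδ' : 0 ≤ ℓ * (Δ - δ) := mul_nonneg (by positivity) (sub_nonneg.2 (hle hδ))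
  have hfδ : AvoidsBoundary f p (ℓ * δ) (2 * δ) (12 * ((ℓ + 1) * ε)) :=
    hfη.mono (by rw [abs_sub_comm, abs_of_nonneg] <;> linarith)
      (by rw [abs_sub_comm, abs_of_nonneg] <;> linarith [hle hδ])
  have hmem : Δ + ε ∈ rankWidths F q X p k ℓ f :=
    hfδ.mem_rankWidths hℓ (by linarith) (by linarith [hle hδ]) (by linarith) (by linarith) hδ
  exact (hle hmem).not_gt (lt_add_of_pos_right Δ hε₀)

end Landscape

section SupportVectors

variable {ι : Type*} {p : ℝ × ℝ} {ℓ : ℕ} {δ : ℝ} {f : ι → ℝ × ℝ}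

/-- A simplex aligned with one of the four axis-parallel edges of a worm, or a pair of simplices
whose join lies on the upper or the lower off-diagonal edge. In a pair `σ`, `τ` the first coordinate
of the join is that of `τ`, as in `JoinOn`. -/
inductive Support (ι : Type*)
  | right (σ : ι)
  | left (σ : ι)
  | top (σ : ι)
  | bottom (σ : ι)
  | upper (σ τ : ι)
  | lower (σ τ : ι)

instance [Finite ι] : Finite (Support ι) := by
  let e : Fin 6 × ι × ι → Support ι
    | (0, σ, _) => .right σ
    | (1, σ, _) => .left σ
    | (2, σ, _) => .top σ
    | (3, σ, _) => .bottom σ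
    | (4, σ, τ) => .upper σ τ
    | (5, σ, τ) => .lower σ τ
  refine Finite.of_surjective e ?_
  rintro (σ | σ | σ | σ | ⟨σ, τ⟩ | ⟨σ, τ⟩)
  exacts [⟨(0, σ, σ), rfl⟩, ⟨(1, σ, σ), rfl⟩, ⟨(2, σ, σ), rfl⟩, ⟨(3, σ, σ), rfl⟩,
    ⟨(4, σ, τ), rfl⟩, ⟨(5, σ, τ), rfl⟩]

/-- The values of `f` realise the given support on the boundary of the worm of width `δ`. -/
def IsActive (p : ℝ × ℝ) (ℓ : ℕ) (δ : ℝ) (f : ι → ℝ × ℝ) : Support ι → Prop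
  | .right σ => (f σ).1 = p.1 + ℓ * δ
  | .left σ => (f σ).1 = p.1 - ℓ * δ
  | .top σ => (f σ).2 = p.2 + ℓ * δ
  | .bottom σ => (f σ).2 = p.2 - ℓ * δ
  | .upper σ τ => JoinOn (upperEdge p ℓ δ) f σ τ
  | .lower σ τ => JoinOn (lowerEdge p ℓ δ) f σ τ

theorem edgeCollar_zero_subset (hℓ : 1 ≤ ℓ) (hδ : 0 ≤ δ) :
    edgeCollar p (ℓ * δ) (2 * δ) 0 ⊆ upperEdge p ℓ δ ∪ lowerEdge p ℓ δ := by
  rintro u ⟨h₁, h₂, h₃⟩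
  rw [add_zero] at h₁ h₂
  have hsum : |u.1 - p.1 + (u.2 - p.2)| = 2 * δ := sub_eq_zero.1 (abs_nonpos_iff.1 h₃)
  have hu : u ∈ worm p ℓ δ := by
    rw [worm_eq_hexagon hℓ hδ]
    exact ⟨h₁, h₂, hsum.le⟩
  rcases eq_or_eq_neg_of_abs_eq hsum with h | h
  · exact .inl ⟨hu, by linarith⟩
  · exact .inr ⟨hu, by linarith⟩

theorem exists_isActive_of_not_avoidsBoundary (hℓ : 1 ≤ ℓ) (hδ : 0 ≤ δ)
    (hf : ¬ AvoidsBoundary f p (ℓ * δ) (2 * δ) 0) : ∃ i, IsActive p ℓ δ f i := by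
  have haligned {x y : ℝ} (h : |(|x - y| - ℓ * δ)| ≤ 0) : x = y + ℓ * δ ∨ x = y - ℓ * δ := by
    rcases eq_or_eq_neg_of_abs_eq (sub_eq_zero.1 (abs_nonpos_iff.1 h)) with h | h
    · exact .inl (by linarith)
    · exact .inr (by linarith)
  simp only [AvoidsBoundary, not_and_or, not_forall, not_lt, not_not] at hf
  rcases hf with ⟨σ, h | h⟩ | ⟨σ, τ, hE, h⟩
  · exact (haligned h).elim (fun h => ⟨.right σ, h⟩) fun h => ⟨.left σ, h⟩
  · exact (haligned h).elim (fun h => ⟨.top σ, h⟩) fun h => ⟨.bottom σ, h⟩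
  · exact (edgeCollar_zero_subset hℓ hδ hE).elim (fun hE => ⟨.upper σ τ, hE, h⟩)
      fun hE => ⟨.lower σ τ, hE, h⟩

theorem JoinOn.sup_eq {E : Set (ℝ × ℝ)} {σ τ : ι} (h : JoinOn E f σ τ) :
    f σ ⊔ f τ = ((f τ).1, (f σ).2) :=
  Prod.ext (sup_of_le_right h.2.1) (sup_of_le_left h.2.2)

variable [DecidableEq ι]

/-- The assignment with entry `a` in the first coordinate of `τ`, entry `b` in the second coordinate
of `σ` and zeros elsewhere. -/
def crossVector (σ τ : ι) (a b : ℝ) : ι → ℝ × ℝ :=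
  fun ρ => ((Pi.single τ a : ι → ℝ) ρ, (Pi.single σ b : ι → ℝ) ρ)

theorem crossVector_fst (σ τ : ι) (a b : ℝ) : (crossVector σ τ a b τ).1 = a :=
  Pi.single_eq_same (M := fun _ => ℝ) τ a

theorem crossVector_snd (σ τ : ι) (a b : ℝ) : (crossVector σ τ a b σ).2 = b :=
  Pi.single_eq_same (M := fun _ => ℝ) σ b

/-- The support assignment of a function whose only active support is the given one. -/
def supportVector (ℓ : ℕ) : Support ι → ι → ℝ × ℝ
  | .right σ => crossVector σ σ ℓ 0
  | .left σ => crossVector σ σ (-ℓ) 0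
  | .top σ => crossVector σ σ 0 ℓ
  | .bottom σ => crossVector σ σ 0 (-ℓ)
  | .upper σ τ => crossVector σ τ 1 1
  | .lower σ τ => crossVector σ τ (-1) (-1)

theorem supportVector_ne_zero (hℓ : 1 ≤ ℓ) (i : Support ι) : supportVector ℓ i ≠ 0 := by
  have hℓ₀ : (ℓ : ℝ) ≠ 0 := by positivity
  have hcross {σ τ : ι} {a b : ℝ} (h : a ≠ 0 ∨ b ≠ 0) : crossVector σ τ a b ≠ 0 := by
    rcases h with h | h <;> intro h₀
    · exact h ((crossVector_fst σ τ a b).symm.trans (congrArg Prod.fst (congrFun h₀ τ)))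
    · exact h ((crossVector_snd σ τ a b).symm.trans (congrArg Prod.snd (congrFun h₀ σ)))
  cases i <;> exact hcross (by simp [hℓ₀])

theorem supportVector_fst_ne_zero {i : Support ι} {σ : ι} (h : (supportVector ℓ i σ).1 ≠ 0) :
    i = .right σ ∨ i = .left σ ∨ (∃ ρ, i = .upper ρ σ) ∨ ∃ ρ, i = .lower ρ σ := by
  cases i <;> simp_all [supportVector, crossVector, Pi.single_apply]

theorem supportVector_snd_ne_zero {i : Support ι} {σ : ι} (h : (supportVector ℓ i σ).2 ≠ 0) :
    i = .top σ ∨ i = .bottom σ ∨ (∃ τ, i = .upper σ τ) ∨ ∃ τ, i = .lower σ τ := by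
  cases i <;> simp_all [supportVector, crossVector, Pi.single_apply]

theorem exists_abs_supportVector_mem (ℓ : ℕ) (i : Support ι) : ∃ m : ℝ, 0 ≤ m ∧
    ∀ σ, |(supportVector ℓ i σ).1| ∈ ({0, m} : Set ℝ) ∧
      |(supportVector ℓ i σ).2| ∈ ({0, m} : Set ℝ) := by
  have hcross {σ τ : ι} {a b m : ℝ} (ha : |a| ∈ ({0, m} : Set ℝ)) (hb : |b| ∈ ({0, m} : Set ℝ))
      (ρ : ι) : |(crossVector σ τ a b ρ).1| ∈ ({0, m} : Set ℝ) ∧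
        |(crossVector σ τ a b ρ).2| ∈ ({0, m} : Set ℝ) := by
    simp only [crossVector, Pi.single_apply]
    split_ifs <;> simp [ha, hb]
  cases i
  case upper | lower => exact ⟨1, zero_le_one, hcross (by simp) (by simp)⟩
  all_goals exact ⟨ℓ, by positivity, hcross (by simp) (by simp)⟩

theorem supportAssignment_eq {c : ι → ℝ × ℝ} (hex : ∃ i, IsActive p ℓ δ f i)
    (hc : ∀ i, IsActive p ℓ δ f i → supportVector ℓ i = c) : supportAssignment p ℓ δ f = c := by
  obtain ⟨i, hi⟩ := hex
  funext σ
  refine Prod.ext ?_ ?_ <;> dsimp only [supportAssignment]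
  · split_ifs with hright hleft hupper hlower
    · simp [← hc (.right σ) hright, supportVector, crossVector]
    · simp [← hc (.left σ) hleft, supportVector, crossVector]
    · obtain ⟨ρ, hupper⟩ := hupper
      simp [← hc (.upper ρ σ) hupper, supportVector, crossVector]
    · obtain ⟨ρ, hlower⟩ := hlower
      simp [← hc (.lower ρ σ) hlower, supportVector, crossVector]
    · by_contra! h
      rw [← hc i hi] at h
      rcases supportVector_fst_ne_zero h.symm with rfl | rfl | ⟨ρ, rfl⟩ | ⟨ρ, rfl⟩
      exacts [hright hi, hleft hi, hupper ⟨ρ, hi⟩, hlower ⟨ρ, hi⟩]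
  · split_ifs with htop hbottom hupper hlower
    · simp [← hc (.top σ) htop, supportVector, crossVector]
    · simp [← hc (.bottom σ) hbottom, supportVector, crossVector]
    · obtain ⟨τ, hupper⟩ := hupper
      simp [← hc (.upper σ τ) hupper, supportVector, crossVector]
    · obtain ⟨τ, hlower⟩ := hlower
      simp [← hc (.lower σ τ) hlower, supportVector, crossVector]
    · by_contra! h
      rw [← hc i hi] at h
      rcases supportVector_snd_ne_zero h.symm with rfl | rfl | ⟨τ, rfl⟩ | ⟨τ, rfl⟩
      exacts [htop hi, hbottom hi, hupper ⟨τ, hi⟩, hlower ⟨τ, hi⟩]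

theorem supportVector_mem (ℓ : ℕ) (i : Support ι) (σ : ι) :
    (supportVector ℓ i σ).1 ∈ ({1, -1, 0, (ℓ : ℝ), -(ℓ : ℝ)} : Set ℝ) ∧
      (supportVector ℓ i σ).2 ∈ ({1, -1, 0, (ℓ : ℝ), -(ℓ : ℝ)} : Set ℝ) := by
  cases i <;> simp only [supportVector, crossVector, Pi.single_apply] <;> split_ifs <;> simp

end SupportVectors

section SupportWidth

variable {ι : Type*} [Fintype ι] {p : ℝ × ℝ} {ℓ : ℕ} {δ : ℝ} {c c' f : ι → ℝ × ℝ}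

/-- The Euclidean inner product with `c`. -/
def dot (c : ι → ℝ × ℝ) : (ι → ℝ × ℝ) →L[ℝ] ℝ :=
  ∑ σ, ((c σ).1 • (ContinuousLinearMap.fst ℝ ℝ ℝ).comp (.proj σ) +
    (c σ).2 • (ContinuousLinearMap.snd ℝ ℝ ℝ).comp (.proj σ))

theorem dot_apply (c g : ι → ℝ × ℝ) :
    dot c g = ∑ σ, ((c σ).1 * (g σ).1 + (c σ).2 * (g σ).2) := by
  simp [dot]

theorem dot_sub_left (c c' g : ι → ℝ × ℝ) : dot (c - c') g = dot c g - dot c' g := by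
  simp only [dot_apply, ← Finset.sum_sub_distrib]
  refine Finset.sum_congr rfl fun σ _ => ?_
  rw [Pi.sub_apply, Prod.fst_sub, Prod.snd_sub]
  ring

theorem dot_self_pos (hc : c ≠ 0) : 0 < dot c c := by
  obtain ⟨σ, hσ⟩ := Function.ne_iff.1 hc
  rw [dot_apply]
  refine Finset.sum_pos' (fun σ _ => add_nonneg (mul_self_nonneg _) (mul_self_nonneg _))
    ⟨σ, Finset.mem_univ _, ?_⟩
  rcases not_and_or.1 (mt Prod.ext_iff.2 hσ) with h | h
  · exact add_pos_of_pos_of_nonneg (mul_self_pos.2 h) (mul_self_nonneg _)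
  · exact add_pos_of_nonneg_of_pos (mul_self_nonneg _) (mul_self_pos.2 h)

theorem dot_crossVector [DecidableEq ι] (σ τ : ι) (a b : ℝ) (g : ι → ℝ × ℝ) :
    dot (crossVector σ τ a b) g = a * (g τ).1 + b * (g σ).2 := by
  simp [dot_apply, crossVector, Pi.single_apply, Finset.sum_add_distrib]

/-- The equality case of the duality between the `ℓ¹`-norm and the sup norm. -/
theorem dot_mul_norm_le {m : ℝ} (hm : 0 ≤ m)
    (hc : ∀ σ, |(c σ).1| ∈ ({0, m} : Set ℝ) ∧ |(c σ).2| ∈ ({0, m} : Set ℝ)) (g : ι → ℝ × ℝ) :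
    dot c g * ‖c‖ ≤ dot c c * ‖g‖ := by
  have hle {x : ℝ} (hx : |x| ∈ ({0, m} : Set ℝ)) : |x| ≤ m := by
    rcases hx with h | h
    exacts [h.trans_le hm, h.le]
  have hmul {x : ℝ} (hx : |x| ∈ ({0, m} : Set ℝ)) : |x| * m = x * x := by
    rw [← abs_mul_abs_self x]
    rcases hx with h | h
    · rw [h, zero_mul, zero_mul]
    · rw [mem_singleton_iff.1 h]
  have hcm : ‖c‖ ≤ m := (pi_norm_le_iff_of_nonneg hm).2 fun σ =>
    norm_prod_le_iff.2 ⟨hle (hc σ).1, hle (hc σ).2⟩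
  have hterm {x y : ℝ} (hy : |y| ≤ ‖g‖) : x * y ≤ |x| * ‖g‖ :=
    (le_abs_self _).trans ((abs_mul x y).trans_le (by gcongr))
  calc dot c g * ‖c‖ ≤ (∑ σ, (|(c σ).1| + |(c σ).2|)) * ‖g‖ * ‖c‖ := by
        refine mul_le_mul_of_nonneg_right ?_ (norm_nonneg c)
        rw [dot_apply, Finset.sum_mul]
        refine Finset.sum_le_sum fun σ _ => ?_
        rw [add_mul]
        exact add_le_add (hterm ((norm_fst_le (g σ)).trans (norm_le_pi_norm g σ)))
          (hterm ((norm_snd_le (g σ)).trans (norm_le_pi_norm g σ)))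
    _ ≤ (∑ σ, (|(c σ).1| + |(c σ).2|)) * ‖g‖ * m := by gcongr
    _ = dot c c * ‖g‖ := by
        rw [mul_right_comm, dot_apply, Finset.sum_mul]
        simp only [add_mul, fun σ => hmul (hc σ).1, fun σ => hmul (hc σ).2]

/-- The multiple of the Euclidean inner product with `c` that takes the value `1` at `c`. -/
def supportFunctional (c : ι → ℝ × ℝ) : (ι → ℝ × ℝ) →L[ℝ] ℝ :=
  (dot c c)⁻¹ • dot c

theorem supportFunctional_apply (c g : ι → ℝ × ℝ) :
    supportFunctional c g = (dot c c)⁻¹ * dot c g := rfl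

theorem supportFunctional_mul_norm_le {m : ℝ} (hm : 0 ≤ m)
    (hc : ∀ σ, |(c σ).1| ∈ ({0, m} : Set ℝ) ∧ |(c σ).2| ∈ ({0, m} : Set ℝ)) (g : ι → ℝ × ℝ) :
    supportFunctional c g * ‖c‖ ≤ supportFunctional c c * ‖g‖ := by
  rcases eq_or_ne c 0 with rfl | hc₀
  · simp [supportFunctional]
  have := (dot_self_pos hc₀).le
  simp only [supportFunctional_apply, mul_assoc]
  gcongr ?_ * ?_
  exact dot_mul_norm_le hm hc g

theorem supportFunctional_injOn : InjOn (supportFunctional (ι := ι)) {0}ᶜ := by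
  intro c hc c' hc' h
  have hcc := (dot_self_pos hc).ne'
  have hcc' := (dot_self_pos hc').ne'
  by_contra hne
  refine (dot_self_pos (sub_ne_zero.2 hne)).ne' ?_
  have h₁ : dot c' c = dot c' c' := by
    have := congr($h c)
    rw [supportFunctional_apply, supportFunctional_apply, inv_mul_cancel₀ hcc, eq_comm,
      inv_mul_eq_iff_eq_mul₀ hcc', mul_one] at this
    exact this
  have h₂ : dot c c' = dot c c := by
    have := congr($h c')
    rw [supportFunctional_apply, supportFunctional_apply, inv_mul_cancel₀ hcc',
      inv_mul_eq_iff_eq_mul₀ hcc, mul_one] at this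
    exact this
  rw [dot_sub_left, map_sub, map_sub, h₁, h₂, sub_self, sub_self, sub_self]

/-- The width of the worm centred at `p` on whose boundary `f` has the support with support
vector `c`. -/
def supportWidth (p : ℝ × ℝ) (c f : ι → ℝ × ℝ) : ℝ :=
  supportFunctional c (f - fun _ => p)

theorem hasFDerivAt_supportWidth (p : ℝ × ℝ) (c f : ι → ℝ × ℝ) :
    HasFDerivAt (supportWidth p c) (supportFunctional c) f :=
  (supportFunctional c).hasFDerivAt.comp f ((hasFDerivAt_id f).sub_const _)

theorem volume_supportWidth_eq (p : ℝ × ℝ) (hc : c ≠ 0) (hc' : c' ≠ 0) (hne : c ≠ c') :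
    volume {f | supportWidth p c f = supportWidth p c' f} = 0 := by
  have hker : (supportFunctional c - supportFunctional c').ker ≠ ⊤ := by
    intro h
    refine hne (supportFunctional_injOn hc hc' (sub_eq_zero.1 ?_))
    exact ContinuousLinearMap.coe_injective (LinearMap.ker_eq_top.1 h)
  have hset : {f | supportWidth p c f = supportWidth p c' f} = (fun f => f + -(fun _ => p)) ⁻¹'
      (supportFunctional c - supportFunctional c').ker := by
    ext f
    simp [supportWidth, ← sub_eq_add_neg, sub_eq_zero]
  rw [hset, measure_preimage_add_right]
  exact Measure.addHaar_submodule _ _ hker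

theorem IsActive.supportWidth_eq [DecidableEq ι] (hℓ : 1 ≤ ℓ) {i : Support ι}
    (h : IsActive p ℓ δ f i) : supportWidth p (supportVector ℓ i) f = δ := by
  have hcc := (dot_self_pos (supportVector_ne_zero hℓ i)).ne'
  have hsum {E : Set (ℝ × ℝ)} {σ τ : ι} (h : JoinOn E f σ τ) :
      (f σ ⊔ f τ).1 + (f σ ⊔ f τ).2 = (f τ).1 + (f σ).2 := by rw [h.sup_eq]
  rw [supportWidth, supportFunctional_apply, inv_mul_eq_iff_eq_mul₀ hcc]
  cases i
  case upper | lower =>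
    have := (hsum h).symm.trans h.1.2
    simp only [supportVector, dot_crossVector, crossVector_fst, crossVector_snd, Pi.sub_apply,
      Prod.fst_sub, Prod.snd_sub]
    linarith
  all_goals
    simp only [IsActive] at h
    simp only [supportVector, dot_crossVector, crossVector_fst, crossVector_snd, Pi.sub_apply,
      Prod.fst_sub, Prod.snd_sub, h]
    ring

end SupportWidth

section NormalizedDerivative

variable {E : Type*} [NormedAddCommGroup E] [NormedSpace ℝ E] {Λ : E → ℝ} {L : E →L[ℝ] ℝ} {f s : E}

theorem HasNormalizedDeriv.unique {g : E} {d d' : ℝ} (h : HasNormalizedDeriv Λ f g d)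
    (h' : HasNormalizedDeriv Λ f g d') : d = d' :=
  tendsto_nhds_unique h h'

theorem hasNormalizedDeriv_of_hasFDerivAt (h : HasFDerivAt Λ L f) (g : E) :
    HasNormalizedDeriv Λ f g (L g / ‖g‖) := by
  refine ((h.hasLineDerivAt g).tendsto_slope_zero.div_const ‖g‖).congr fun α => ?_
  rw [smul_eq_mul, inv_mul_eq_div, div_div]

theorem isGreatest_normalizedDeriv (h : HasFDerivAt Λ L f) (hs : s ≠ 0)
    (hmax : ∀ g, L g * ‖s‖ ≤ L s * ‖g‖) :
    IsGreatest {d | ∃ g, g ≠ 0 ∧ HasNormalizedDeriv Λ f g d} (L s / ‖s‖) := by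
  refine ⟨⟨s, hs, hasNormalizedDeriv_of_hasFDerivAt h s⟩, ?_⟩
  rintro d ⟨g, hg, hd⟩
  rw [hd.unique (hasNormalizedDeriv_of_hasFDerivAt h g),
    div_le_div_iff₀ (norm_pos_iff.2 hg) (norm_pos_iff.2 hs)]
  exact hmax g

end NormalizedDerivative

section Genericity

theorem exists_eventuallyEq_of_eventually_exists_eq {E Y α : Type*} [TopologicalSpace E]
    [TopologicalSpace Y] [T2Space Y] {C : Set α} (hC : C.Finite) {Λ : E → Y} {w : α → E → Y} {x : E}
    (hΛ : ContinuousAt Λ x) (hw : ∀ c ∈ C, ContinuousAt (w c) x) (hinj : InjOn (fun c => w c x) C)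
    (h : ∀ᶠ y in 𝓝 x, ∃ c ∈ C, Λ y = w c y) : ∃ c ∈ C, Λ =ᶠ[𝓝 x] w c := by
  obtain ⟨c, hc, hcx⟩ := h.self_of_nhds
  have hne : ∀ᶠ y in 𝓝 x, ∀ c' ∈ C, c' ≠ c → Λ y ≠ w c' y := by
    refine (eventually_all_finite hC).2 fun c' hc' => ?_
    by_cases hcc' : c' = c
    · exact .of_forall fun y h => absurd hcc' h
    · have hx : Λ x ≠ w c' x := fun hx => hcc' (hinj hc' hc (hx.symm.trans hcx))
      exact ((hΛ.ne_iff_eventually_ne (hw c' hc')).1 hx).mono fun y hy _ => hy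
  refine ⟨c, hc, ?_⟩
  filter_upwards [h, hne] with y ⟨c', hc', hy⟩ hne
  by_contra hyc
  exact hne c' hc' (by rintro rfl; exact hyc hy) hy

theorem ae_injOn_supportWidth {ι : Type*} [Fintype ι] [DecidableEq ι] (p : ℝ × ℝ) {ℓ : ℕ}
    (hℓ : 1 ≤ ℓ) : ∀ᵐ f : ι → ℝ × ℝ,
      InjOn (fun c => supportWidth p c f) (range (supportVector ℓ)) := by
  simp only [InjOn, forall_mem_range, ae_all_iff]
  intro i j
  rcases eq_or_ne (supportVector (ι := ι) ℓ i) (supportVector ℓ j) with hij | hij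
  · exact .of_forall fun f _ => hij
  · have hnull := volume_supportWidth_eq p (supportVector_ne_zero hℓ i)
      (supportVector_ne_zero hℓ j) hij
    exact (measure_eq_zero_iff_ae_notMem.1 hnull).mono fun f hf h => absurd h hf

variable {F : Type u} [Field F] {V : Type v} [LinearOrder V] {q : ℕ}
  {X : PreAbstractSimplicialComplex V} {p : ℝ × ℝ} {k ℓ : ℕ} {f : X.faces → ℝ × ℝ}

theorem exists_isActive_Lam [Finite X.faces] (hk : 1 ≤ k) (hℓ : 1 ≤ ℓ)
    (hpos : 0 < Lam F q X p k ℓ f) : ∃ i, IsActive p ℓ (Lam F q X p k ℓ f) f i :=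
  exists_isActive_of_not_avoidsBoundary hℓ hpos.le (not_avoidsBoundary_Lam hk hℓ hpos)

theorem hasFDerivAt_Lam_of_eq_zero [Finite X.faces]
    (hf : DifferentiableAt ℝ (Lam F q X p k ℓ) f)
    (hzero : Lam F q X p k ℓ f = 0) :
    HasFDerivAt (𝕜 := ℝ) (Lam F q X p k ℓ) 0 f := by
  have := Fintype.ofFinite X.faces
  have hmin : IsLocalMin (Lam F q X p k ℓ) f :=
    .of_forall fun f' => hzero.trans_le (Lam_nonneg F q X p k ℓ f')
  have hfderiv : fderiv ℝ (Lam F q X p k ℓ) f = 0 := hmin.fderiv_eq_zero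
  exact hfderiv ▸ hf.hasFDerivAt

theorem exists_hasFDerivAt_Lam [Fintype X.faces] (hk : 1 ≤ k) (hℓ : 1 ≤ ℓ)
    (hinj : InjOn (fun c => supportWidth p c f) (range (supportVector ℓ)))
    (hpos : 0 < Lam F q X p k ℓ f) :
    ∃ i, supportVector ℓ i = supportAssignment p ℓ (Lam F q X p k ℓ f) f ∧
      HasFDerivAt (Lam F q X p k ℓ) (supportFunctional (supportVector ℓ i)) f := by
  have hcont : Continuous (Lam F q X p k ℓ) := (lipschitzWith_Lam hk hℓ).continuous
  have hmem : ∀ᶠ f' in 𝓝 f, ∃ c ∈ range (supportVector ℓ),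
      Lam F q X p k ℓ f' = supportWidth p c f' := by
    filter_upwards [hcont.continuousAt.eventually (lt_mem_nhds hpos)] with f' hpos'
    obtain ⟨i, hi⟩ := exists_isActive_Lam hk hℓ hpos'
    exact ⟨_, ⟨i, rfl⟩, (hi.supportWidth_eq hℓ).symm⟩
  obtain ⟨_, ⟨i, rfl⟩, hi⟩ := exists_eventuallyEq_of_eventually_exists_eq (finite_range _)
    hcont.continuousAt (fun c _ => (hasFDerivAt_supportWidth p c f).continuousAt) hinj hmem
  refine ⟨i, (supportAssignment_eq (exists_isActive_Lam hk hℓ hpos) fun j hj => ?_).symm,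
    (hasFDerivAt_supportWidth p _ f).congr_of_eventuallyEq hi⟩
  exact hinj ⟨j, rfl⟩ ⟨i, rfl⟩ ((hj.supportWidth_eq hℓ).trans hi.self_of_nhds)

end Genericity

end GRIL

end

theorem mainTheorem4 {F : Type*} [Field F] {V : Type*} [LinearOrder V] (q : ℕ)
    (X : PreAbstractSimplicialComplex V) [Fintype X.faces] (hX : X.faces.Nonempty)
    (p : ℝ × ℝ) (k ℓ : ℕ) (hk : 1 ≤ k) (hℓ : 1 ≤ ℓ) :
    ∃ Z : Set (X.faces → ℝ × ℝ), volume Z = 0 ∧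
      ∀ f : X.faces → ℝ × ℝ, f ∉ Z →
        (∀ σ τ : X.faces, σ ≠ τ → (f σ).1 ≠ (f τ).1 ∧ (f σ).2 ≠ (f τ).2) →
        ∃ s : X.faces → ℝ × ℝ,
          (∀ σ, (s σ).1 ∈ ({1, -1, 0, (ℓ : ℝ), -(ℓ : ℝ)} : Set ℝ) ∧
            (s σ).2 ∈ ({1, -1, 0, (ℓ : ℝ), -(ℓ : ℝ)} : Set ℝ)) ∧
          s ≠ 0 ∧
          (0 < GRIL.Lam F q X p k ℓ f →
            s = GRIL.supportAssignment p ℓ (GRIL.Lam F q X p k ℓ f) f) ∧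
          (∀ g : X.faces → ℝ × ℝ, g ≠ 0 →
            ∃ d : ℝ, GRIL.HasNormalizedDeriv (GRIL.Lam F q X p k ℓ) f g d) ∧
          ∃ D : ℝ, GRIL.HasNormalizedDeriv (GRIL.Lam F q X p k ℓ) f s D ∧
            IsGreatest {d : ℝ | ∃ g : X.faces → ℝ × ℝ, g ≠ 0 ∧
              GRIL.HasNormalizedDeriv (GRIL.Lam F q X p k ℓ) f g d} D := by
  have hgeneric : ∀ᵐ f, DifferentiableAt ℝ (GRIL.Lam F q X p k ℓ) f ∧
      InjOn (fun c => GRIL.supportWidth p c f) (range (GRIL.supportVector ℓ)) :=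
    (GRIL.lipschitzWith_Lam hk hℓ).ae_differentiableAt.and (GRIL.ae_injOn_supportWidth p hℓ)
  refine ⟨_, ae_iff.1 hgeneric, fun f hf _ => ?_⟩
  obtain ⟨hdiff, hinj⟩ := not_not.1 hf
  rcases (GRIL.Lam_nonneg F q X p k ℓ f).eq_or_lt with hzero | hpos
  · have hderiv := GRIL.hasFDerivAt_Lam_of_eq_zero hdiff hzero.symm
    have : Nonempty X.faces := hX.to_subtype
    have hs : (1 : X.faces → ℝ × ℝ) ≠ 0 := one_ne_zero
    exact ⟨1, fun σ => by simp, hs, fun hpos => absurd hzero hpos.ne,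
      fun g _ => ⟨_, GRIL.hasNormalizedDeriv_of_hasFDerivAt hderiv g⟩, _,
      GRIL.hasNormalizedDeriv_of_hasFDerivAt hderiv 1,
      GRIL.isGreatest_normalizedDeriv hderiv hs fun g => by simp⟩
  · obtain ⟨i, hi, hderiv⟩ := GRIL.exists_hasFDerivAt_Lam hk hℓ hinj hpos
    have hs := GRIL.supportVector_ne_zero hℓ i
    obtain ⟨m, hm, habs⟩ := GRIL.exists_abs_supportVector_mem ℓ i
    exact ⟨_, GRIL.supportVector_mem ℓ i, hs, fun _ => hi,
      fun g _ => ⟨_, GRIL.hasNormalizedDeriv_of_hasFDerivAt hderiv g⟩, _,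
      GRIL.hasNormalizedDeriv_of_hasFDerivAt hderiv _,
      GRIL.isGreatest_normalizedDeriv hderiv hs (GRIL.supportFunctional_mul_norm_le hm habs)⟩
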